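/- The language of urelement set theory has the binary relation symbol $\in$ and a unary predicate $\mathscr{A}$ for urelements; a \emph{set} is an object that is not an urelement. $\mathrm{ZFU_R}$ consists of: urelements have no members; Extensionality for sets; Foundation; Pairing; Union; Powerset (for every $x$ there is a set whose members are exactly the sets included in $x$); Infinity; the Separation scheme; and the Replacement scheme (both with parameters). The DC-scheme states, for every formula $\varphi$: for all $u$, if for every $x$ there is some $y$ with $\varphi(x,y,u)$, then for every $p$ there is a function $s$ with domain $\omega$ such that $s(0)=p$ and $\varphi(s(n),s(n+1),u)$ for every $n<\omega$. Let $U$ be a model of $\mathrm{ZFU_R}$ + DC-scheme, equipped with its definable classes, i.e. the subsets of $U$ that are first-order definable in $U$ with parameters. A map $X\mapsto\epsilon X$ from the definable classes of $U$ to the objects of $U$ \emph{fulfills Basic Law V} if for all definable classes $X,Y$: $\epsilon X=\epsilon Y \leftrightarrow \forall x\,(x\in X\leftrightarrow x\in Y)$. Such a map is \emph{definable} (respectively \emph{parametrically definable}) if the relation $\epsilon X=y$ is defined in $U$ by a second-order formula, whose class quantifiers range over the definable classes of $U$, without parameters (respectively with definable classes and objects of $U$ as parameters). \textbf{Theorem.}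 The following are equivalent. \begin{enumerate} \item $U\models$ ``the urelements form a set'', i.e. some set of $U$ has exactly the urelements of $U$ as its members. \item $U$ has a definable map that fulfills Basic Law V. \item $U$ has a parametrically definable map that fulfills Basic Law V. \end{enumerate} -/

import Mathlib

namespace UrelementSet

open FirstOrder

universe u

/-- The relation symbols of urelement set theory: membership (binary) and
"is an urelement" (unary). -/
inductive SetRel : ℕ → Type
  | mem : SetRel 2
  | ur : SetRel 1

/-- The first-order language of urelement set theory. -/
def setLang : FirstOrder.Language.{0, 0} := ⟨fun _ => Empty, SetRel⟩

section Axioms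

variable {U : Type u} [setLang.Structure U]

/-- `x ∈ y` in the structure `U`. -/
def Mem (x y : U) : Prop := FirstOrder.Language.Structure.RelMap (L := setLang) SetRel.mem ![x, y]

/-- `x` is an urelement of `U`. -/
def IsUr (x : U) : Prop := FirstOrder.Language.Structure.RelMap (L := setLang) SetRel.ur ![x]

/-- `x` is a set, i.e. not an urelement. -/
def IsSet (x : U) : Prop := ¬ IsUr x

/-- `x` is the empty set (an urelement also has no members, but is not the empty set). -/
def IsEmptySet (x : U) : Prop := IsSet x ∧ ∀ z, ¬ Mem z x

/-- `y` is the set `{a, b}`. -/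
def IsUPair (y a b : U) : Prop := IsSet y ∧ ∀ z, Mem z y ↔ z = a ∨ z = b

/-- `q` is the (Kuratowski) ordered pair `⟨a, b⟩ = {{a}, {a, b}}`. -/
def IsOPair (q a b : U) : Prop := ∃ c d, IsUPair c a a ∧ IsUPair d a b ∧ IsUPair q c d

/-- `y = x ∪ {x}`. -/
def IsSucc (y x : U) : Prop := IsSet y ∧ ∀ z, Mem z y ↔ Mem z x ∨ z = x

/-- `s` contains the empty set and is closed under `x ↦ x ∪ {x}`. -/
def IsInductive (s : U) : Prop :=
  (∃ e, IsEmptySet e ∧ Mem e s) ∧ ∀ x, Mem x s → ∃ y, IsSucc y x ∧ Mem y s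

/-- `w` is the set `ω` of the structure `U`: the least inductive set. -/
def IsOmega (w : U) : Prop :=
  IsSet w ∧ IsInductive w ∧ ∀ v, IsInductive v → ∀ x, Mem x w → Mem x v

/-- `⟨n, y⟩ ∈ s`; for a function `s` this says `s(n) = y`. -/
def App (s n y : U) : Prop := ∃ q, Mem q s ∧ IsOPair q n y

/-- `s` is, in the sense of `U`, a function with domain `w`. -/
def IsFunOn (s w : U) : Prop :=
  IsSet s ∧ (∀ q, Mem q s → ∃ n y, Mem n w ∧ IsOPair q n y) ∧ ∀ n, Mem n w → ∃! y, App s n y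

variable (U)

/-- `C` is a definable class of `U`: first-order definable, with parameters from `U` allowed. -/
def IsDefClass (C : Set U) : Prop := (Set.univ : Set U).Definable₁ setLang C

/-- `R` is a definable binary relation on `U`: first-order definable with parameters. -/
def IsDefRel (R : U → U → Prop) : Prop :=
  (Set.univ : Set U).Definable₂ setLang {p : U × U | R p.1 p.2}

/-- `U` is a model of `ZFU_R`. A scheme holds in `U` when it holds for every
formula and every choice of parameters, i.e. for every definable class or relation. -/
structure IsModelZFUR : Prop where
  urelements : ∀ x : U, IsUr x → ∀ z, ¬ Mem z x
  extensionality : ∀ x y : U, IsSet x → IsSet y → (∀ z, Mem z x ↔ Mem z y) → x = y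
  foundation : ∀ x : U, (∃ y, Mem y x) → ∃ y, Mem y x ∧ ∀ z, ¬ (Mem z y ∧ Mem z x)
  pairing : ∀ a b : U, ∃ y, IsUPair y a b
  union : ∀ x : U, ∃ y, IsSet y ∧ ∀ z, Mem z y ↔ ∃ t, Mem t x ∧ Mem z t
  powerset : ∀ x : U, ∃ y, IsSet y ∧ ∀ z, Mem z y ↔ IsSet z ∧ ∀ t, Mem t z → Mem t x
  infinity : ∃ s : U, IsSet s ∧ IsInductive s
  separation : ∀ C : Set U, IsDefClass U C →
    ∀ x : U, ∃ y, IsSet y ∧ ∀ z, Mem z y ↔ Mem z x ∧ z ∈ C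
  replacement : ∀ R : U → U → Prop, IsDefRel U R →
    ∀ x : U, (∀ z, Mem z x → ∃! t, R z t) →
      ∃ y, IsSet y ∧ ∀ t, Mem t y ↔ ∃ z, Mem z x ∧ R z t

/-- `U` satisfies the DC-scheme: if a definable relation `R` has no terminal node, then for
every `p` there is in `U` a function `s` with domain `ω` such that `s(0) = p` and
`R (s(n)) (s(n+1))` for all `n ∈ ω`. -/
def DCScheme : Prop :=
  ∀ R : U → U → Prop, IsDefRel U R → (∀ x, ∃ y, R x y) →
    ∀ p : U, ∃ s w : U, IsOmega w ∧ IsFunOn s w ∧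
      (∀ e, IsEmptySet e → App s e p) ∧
      ∀ n m, Mem n w → IsSucc m n → ∀ x y, App s n x → App s m y → R x y

/-- `U` satisfies "the urelements form a set". -/
def UrelementsFormSet : Prop := ∃ a : U, IsSet a ∧ ∀ x, Mem x a ↔ IsUr x

/-- The definable classes of `U`. -/
def DefClass : Type u := {C : Set U // IsDefClass U C}

end Axioms

/-- The relation symbols of the language of class theory with urelements: membership between
objects, being an urelement, being a class, and membership of an object in a class. -/
inductive ClassRel : ℕ → Type
  | mem : ClassRel 2
  | ur : ClassRel 1
  | isClass : ClassRel 1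
  | inClass : ClassRel 2

/-- The (two-sorted) second-order language of urelement set theory, presented as a
one-sorted language with a predicate for the sort of classes. -/
def classLang : FirstOrder.Language.{0, 0} := ⟨fun _ => Empty, ClassRel⟩

section Classes

variable (U : Type u) [setLang.Structure U]

/-- `U` equipped with its definable classes: the left summand is the sort of objects, the right
summand the sort of classes. -/
abbrev WithClasses : Type u := U ⊕ DefClass U

/-- The second-order structure `U` equipped with its definable classes. Formulas of `classLang`
in this structure are second-order formulas whose class quantifiers range over the definable
classes. -/
instance : classLang.Structure (WithClasses U) where
  funMap := fun f => Empty.elim f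
  RelMap := fun r => match r with
    | ClassRel.mem => fun v => ∃ x y : U, v 0 = Sum.inl x ∧ v 1 = Sum.inl y ∧ Mem x y
    | ClassRel.ur => fun v => ∃ x : U, v 0 = Sum.inl x ∧ IsUr x
    | ClassRel.isClass => fun v => ∃ X : DefClass U, v 0 = Sum.inr X
    | ClassRel.inClass => fun v =>
        ∃ (x : U) (X : DefClass U), v 0 = Sum.inl x ∧ v 1 = Sum.inr X ∧ x ∈ X.1

variable {U}

/-- The graph of a map from definable classes to objects. -/
def mapGraph (F : DefClass U → U) : Set (WithClasses U × WithClasses U) :=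
  {p | ∃ X : DefClass U, p = (Sum.inr X, Sum.inl (F X))}

/-- `F` is definable by a second-order formula without parameters. -/
def IsDefinableMap (F : DefClass U → U) : Prop :=
  (∅ : Set (WithClasses U)).Definable₂ classLang (mapGraph F)

/-- `F` is definable by a second-order formula with parameters (objects and definable classes). -/
def IsParamDefinableMap (F : DefClass U → U) : Prop :=
  (Set.univ : Set (WithClasses U)).Definable₂ classLang (mapGraph F)

/-- `F` fulfills Basic Law V. -/
def FulfillsBLV (F : DefClass U → U) : Prop :=
  ∀ X Y : DefClass U, F X = F Y ↔ ∀ x : U, x ∈ X.1 ↔ x ∈ Y.1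

end Classes

end UrelementSet

/-!
If the urelements form a set, the objects of bounded rank form a set, and Scott's trick selects a
canonical nonempty set from every nonempty definable class (`exists_scott_set`). Ranks are compared
by simulation (`RankLe`), so that ordinals are not needed. It remains to code a definable class `X`
by objects in a way that a single second-order formula can express. Formulas are coded by objects,
assignments by sets of pairs of a label and a value, and `Sat k` is the satisfaction relation for
the codes of level `k`: level zero treats atomic formulas, and each further level allows one more
implication or quantifier. Each `Sat k` is definable, and every definable class has a code at some
level (`exists_codesAt`). A definable class is a run of length `n` if its sections at `0, …, n`
obey the recursion of the hierarchy; by induction in the model two runs agree wherever both are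
defined (`IsRun.unique`), so "`n` is the least level at which `X` has a code" is expressed by
quantifying over runs. The value at `X` is the set of all `⟨n, c⟩` with this `n` and with `c` a code
of `X` of least rank (`IsCode`). In a model with nonstandard natural numbers nothing changes: every
definable class has a code at a standard level.

Conversely, let `F` be parametrically definable and fulfill Basic Law V, and suppose that the
urelements do not form a set. A definable involution of the urelements extends to an automorphism
of `U` (`exists_isInvAut`), which acts on the definable classes and commutes with `F` once it fixes
a suitable set `e` pointwise (`exists_support_of_isParamDefinableMap`). The DC-scheme provides a
sequence `s` of disjoint pairs of urelements outside of `e` (`exists_disjoint_pairs`). Let `X` be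
the class of all objects that agree with `s` at almost all natural numbers, and `y = F X`. If some
term `c` of `s` occurs in the transitive closure of `y`, then the transposition of `c` with a fresh
urelement `c'` fixes `X`, hence `y`, which is absurd as `c'` does not occur in the transitive closure
of `y`. Otherwise the involution that swaps every pair of `s` fixes `y`; since it moves `X`, this
contradicts the injectivity of `F`. The DC-scheme is also used for the existence of transitive
closures (`exists_isTrans`).

Definability in `U` is tracked by the type classes `Dfn` and `DfnFun`, and second-order definability
without parameters by `Dfn2`; instance search performs the induction on formulas.
-/

namespace UrelementSet

open FirstOrder

universe u

/-! ### Calculus of first-order definability -/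

section FirstOrderDefinability

variable {U : Type u} [setLang.Structure U] {n : ℕ}

/-- `P` is a first-order definable predicate on `n`-tuples, parameters allowed. It is a type class,
so that instance search carries out the induction on the shape of a formula. -/
class Dfn (P : (Fin n → U) → Prop) : Prop where
  out : (Set.univ : Set U).Definable setLang {v | P v}

/-- `f` is a first-order definable function on `n`-tuples, parameters allowed. -/
class DfnFun (f : (Fin n → U) → U) : Prop where
  out : (Set.univ : Set U).DefinableFun setLang f

instance DfnFun.var (i : Fin n) : DfnFun (U := U) (fun v => v i) := ⟨Set.DefinableFun.proj _⟩

instance DfnFun.const (c : U) : DfnFun (n := n) (fun _ => c) :=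
  ⟨FirstOrder.Language.definableFun_const _ _ (Set.mem_univ c)⟩

/-- Terms stay definable when quantifiers add variables to the context. -/
instance DfnFun.weaken {k : ℕ} (f : (Fin n → U) → U) (ρ : Fin n → Fin k) [hf : DfnFun f] :
    DfnFun (fun v : Fin k → U => f (fun i => v (ρ i))) :=
  ⟨Set.DefinableFun.comp (g := fun v i => v (ρ i)) (fun _ => Set.DefinableFun.proj _) hf.out⟩

theorem Dfn.congr {P Q : (Fin n → U) → Prop} [hP : Dfn P] (h : ∀ v, Q v ↔ P v) : Dfn Q := by
  have : Q = P := funext fun v => propext (h v)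
  rwa [this]

theorem Dfn.subst {k : ℕ} {P : (Fin k → U) → Prop} (hP : Dfn P) (F : (Fin n → U) → Fin k → U)
    (hF : ∀ i, DfnFun (fun v => F v i)) : Dfn (fun v => P (F v)) :=
  ⟨Set.Definable.preimage_map (F := F) (fun i => (hF i).out) hP.out⟩

/-- `P` may be used as a definable predicate of terms. -/
theorem Dfn.app₁ {P : U → Prop} (hP : Dfn (fun v : Fin 1 → U => P (v 0)))
    (f : (Fin n → U) → U) [hf : DfnFun f] : Dfn (fun v => P (f v)) :=
  hP.subst (fun v => ![f v]) (fun i => by fin_cases i; exact hf)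

theorem Dfn.app₂ {P : U → U → Prop} (hP : Dfn (fun v : Fin 2 → U => P (v 0) (v 1)))
    (f g : (Fin n → U) → U) [hf : DfnFun f] [hg : DfnFun g] : Dfn (fun v => P (f v) (g v)) :=
  hP.subst (fun v => ![f v, g v]) (fun i => by fin_cases i; exacts [hf, hg])

variable {P Q : (Fin n → U) → Prop}

instance Dfn.and [hP : Dfn P] [hQ : Dfn Q] : Dfn (fun v => P v ∧ Q v) := ⟨hP.out.inter hQ.out⟩

instance Dfn.or [hP : Dfn P] [hQ : Dfn Q] : Dfn (fun v => P v ∨ Q v) := ⟨hP.out.union hQ.out⟩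

instance Dfn.not [hP : Dfn P] : Dfn (fun v => ¬ P v) := ⟨hP.out.compl⟩

instance Dfn.imp [Dfn P] [Dfn Q] : Dfn (fun v => P v → Q v) :=
  .congr (P := fun v => ¬ P v ∨ Q v) fun _ => imp_iff_not_or

instance Dfn.iff [Dfn P] [Dfn Q] : Dfn (fun v => P v ↔ Q v) :=
  .congr (P := fun v => (P v → Q v) ∧ (Q v → P v)) fun _ => iff_def

instance Dfn.constProp (p : Prop) : Dfn (U := U) (n := n) (fun _ => p) := by
  by_cases hp : p <;> refine ⟨?_⟩ <;> simp only [hp]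
  exacts [Set.definable_univ, Set.definable_empty]

instance Dfn.ex {P : (Fin n → U) → U → Prop}
    [hP : Dfn (fun v : Fin (n + 1) → U => P (fun i => v i.succ) (v 0))] :
    Dfn (fun v => ∃ x, P v x) := by
  refine ⟨?_⟩
  convert! hP.out.image_comp (Fin.succ : Fin n → Fin (n + 1)) using 1
  ext v
  constructor
  · rintro ⟨x, hx⟩
    exact ⟨Fin.cons x v, by simpa using hx, by ext; simp⟩
  · rintro ⟨w, hw, rfl⟩
    exact ⟨w 0, hw⟩

instance Dfn.all {P : (Fin n → U) → U → Prop}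
    [hP : Dfn (fun v : Fin (n + 1) → U => P (fun i => v i.succ) (v 0))] :
    Dfn (fun v => ∀ x, P v x) :=
  .congr (P := fun v => ¬ ∃ x, ¬ P v x) fun _ => by push Not; rfl

section Atoms

variable (f g h : (Fin n → U) → U) [DfnFun f] [DfnFun g] [DfnFun h]

instance Dfn.eq : Dfn (fun v => f v = g v) :=
  Dfn.app₂ (P := (· = ·)) ⟨⟨(Language.var 0).equal (Language.var 1), by ext; simp⟩⟩ f g

instance Dfn.mem : Dfn (fun v => Mem (f v) (g v)) := by
  refine Dfn.app₂ (P := Mem) ⟨?_⟩ f g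
  refine Set.Definable.mono (A := ∅) ?_ (Set.empty_subset _)
  rw [Set.empty_definable_iff]
  refine ⟨Language.Relations.formula₂ (L := setLang) SetRel.mem (.var 0) (.var 1), ?_⟩
  ext v
  exact (Language.Formula.realize_rel₂ (L := setLang) (M := U) (R := SetRel.mem) (v := v)
    (t₁ := .var 0) (t₂ := .var 1)).symm

instance Dfn.isUr : Dfn (fun v => IsUr (f v)) := by
  refine Dfn.app₁ (P := IsUr) ⟨?_⟩ f
  refine Set.Definable.mono (A := ∅) ?_ (Set.empty_subset _)
  rw [Set.empty_definable_iff]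
  refine ⟨Language.Relations.formula₁ (L := setLang) SetRel.ur (.var 0), ?_⟩
  ext v
  exact (Language.Formula.realize_rel₁ (L := setLang) (M := U) (R := SetRel.ur) (v := v)
    (t := .var 0)).symm

instance : Dfn (fun v => IsSet (f v)) := by unfold IsSet; infer_instance
instance : Dfn (fun v => IsEmptySet (f v)) := by unfold IsEmptySet; infer_instance
instance : Dfn (fun v => IsUPair (f v) (g v) (h v)) := by unfold IsUPair; infer_instance
instance : Dfn (fun v => IsOPair (f v) (g v) (h v)) := by unfold IsOPair; infer_instance
instance : Dfn (fun v => IsSucc (f v) (g v)) := by unfold IsSucc; infer_instance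
instance : Dfn (fun v => App (f v) (g v) (h v)) := by unfold App; infer_instance

end Atoms
end FirstOrderDefinability

/-! ### Elementary set theory inside a model -/

/-- `U` is a model of `ZFU_R` and of the DC-scheme. -/
class ZFUModel (U : Type u) [setLang.Structure U] : Prop where
  zfu : IsModelZFUR U
  dc : DCScheme U

section Basic

variable {U : Type u} [setLang.Structure U] {n : ℕ}

theorem DfnFun.of_graph {f : (Fin n → U) → U}
    (h : Dfn (fun v : Fin (n + 1) → U => v 0 = f (fun i => v i.succ))) : DfnFun f := by
  refine ⟨?_⟩
  unfold Set.DefinableFun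
  convert! h.out.preimage_comp (Fin.cons none some : Fin (n + 1) → Option (Fin n)) using 1
  ext v
  simp [Function.tupleGraph, eq_comm, Function.comp_def]

variable [hU : ZFUModel U]

theorem ext_set {x y : U} (hx : IsSet x) (hy : IsSet y) (h : ∀ z, Mem z x ↔ Mem z y) : x = y :=
  hU.zfu.extensionality x y hx hy h

theorem exists_sep (P : U → Prop) [hP : Dfn (fun v : Fin 1 → U => P (v 0))] (x : U) :
    ∃ y, IsSet y ∧ ∀ z, Mem z y ↔ Mem z x ∧ P z :=
  hU.zfu.separation {z | P z} hP.out x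

theorem exists_replacement (R : U → U → Prop) [hR : Dfn (fun v : Fin 2 → U => R (v 0) (v 1))]
    (x : U) (h : ∀ z, Mem z x → ∃! t, R z t) :
    ∃ y, IsSet y ∧ ∀ t, Mem t y ↔ ∃ z, Mem z x ∧ R z t :=
  hU.zfu.replacement R hR.out x h

theorem exists_emptySet : ∃ e : U, IsEmptySet e := by
  obtain ⟨s, -, ⟨e, he, -⟩, -⟩ := hU.zfu.infinity
  exact ⟨e, he⟩

variable (U) in
/-- The empty set of the model. -/
noncomputable def emp : U := (exists_emptySet (U := U)).choose

theorem not_mem_emp (z : U) : ¬ Mem z (emp U) := (exists_emptySet (U := U)).choose_spec.2 z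

theorem isSet_emp : IsSet (emp U) := (exists_emptySet (U := U)).choose_spec.1

theorem isEmptySet_iff {x : U} : IsEmptySet x ↔ x = emp U := by
  refine ⟨fun h => ext_set h.1 isSet_emp fun z => ?_, ?_⟩
  · simp [h.2 z, not_mem_emp]
  · rintro rfl
    exact ⟨isSet_emp, not_mem_emp⟩

/-- The unordered pair `{a, b}` of the model. -/
noncomputable def up (a b : U) : U := (hU.zfu.pairing a b).choose

theorem isSet_up (a b : U) : IsSet (up a b) := (hU.zfu.pairing a b).choose_spec.1

@[simp] theorem mem_up {a b z : U} : Mem z (up a b) ↔ z = a ∨ z = b :=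
  (hU.zfu.pairing a b).choose_spec.2 z

theorem isUPair_iff {y a b : U} : IsUPair y a b ↔ y = up a b := by
  refine ⟨fun h => ext_set h.1 (isSet_up a b) fun z => ?_, ?_⟩
  · rw [h.2, mem_up]
  · rintro rfl
    exact ⟨isSet_up a b, fun z => mem_up⟩

/-- The ordered pair `⟨a, b⟩` of the model. -/
noncomputable def op (a b : U) : U := up (up a a) (up a b)

theorem isOPair_iff {q a b : U} : IsOPair q a b ↔ q = op a b := by
  simp [IsOPair, isUPair_iff, op]

theorem up_eq_up {a b c d : U} (h : up a b = up c d) : (a = c ∧ b = d) ∨ (a = d ∧ b = c) := by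
  have h1 : ∀ z, (z = a ∨ z = b) ↔ (z = c ∨ z = d) := fun z => by rw [← mem_up, ← mem_up, h]
  have ha := h1 a
  have hb := h1 b
  have hc := h1 c
  have hd := h1 d
  grind

@[simp] theorem op_inj {a b c d : U} : op a b = op c d ↔ a = c ∧ b = d := by
  refine ⟨fun h => ?_, by rintro ⟨rfl, rfl⟩; rfl⟩
  rcases up_eq_up h with ⟨h1, h2⟩ | ⟨h1, h2⟩ <;>
  · have h1 := up_eq_up h1
    have h2 := up_eq_up h2
    grind

/-- The union `⋃ x` of the model. -/
noncomputable def sUn (x : U) : U := (hU.zfu.union x).choose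

theorem isSet_sUn (x : U) : IsSet (sUn x) := (hU.zfu.union x).choose_spec.1

@[simp] theorem mem_sUn {x z : U} : Mem z (sUn x) ↔ ∃ t, Mem t x ∧ Mem z t :=
  (hU.zfu.union x).choose_spec.2 z

/-- The union `a ∪ b` of the model. -/
noncomputable def un (a b : U) : U := sUn (up a b)

theorem isSet_un (a b : U) : IsSet (un a b) := isSet_sUn _

@[simp] theorem mem_un {a b z : U} : Mem z (un a b) ↔ Mem z a ∨ Mem z b := by
  simp [un, or_and_right, exists_or]

/-- The successor `x ∪ {x}` of the model. -/
noncomputable def suc (x : U) : U := un x (up x x)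

theorem isSet_suc (x : U) : IsSet (suc x) := isSet_un _ _

@[simp] theorem mem_suc {x z : U} : Mem z (suc x) ↔ Mem z x ∨ z = x := by simp [suc]

theorem isSucc_iff {y x : U} : IsSucc y x ↔ y = suc x := by
  refine ⟨fun h => ext_set h.1 (isSet_suc x) fun z => ?_, ?_⟩
  · rw [h.2, mem_suc]
  · rintro rfl
    exact ⟨isSet_suc x, fun z => mem_suc⟩

@[simp] theorem app_iff {s a b : U} : App s a b ↔ Mem (op a b) s := by
  simp [App, isOPair_iff]

instance DfnFun.up (f g : (Fin n → U) → U) [DfnFun f] [DfnFun g] :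
    DfnFun (fun v => up (f v) (g v)) :=
  .of_graph (.congr fun _ => isUPair_iff.symm)

instance DfnFun.op (f g : (Fin n → U) → U) [DfnFun f] [DfnFun g] :
    DfnFun (fun v => op (f v) (g v)) :=
  .of_graph (.congr fun _ => isOPair_iff.symm)

instance DfnFun.suc (f : (Fin n → U) → U) [DfnFun f] : DfnFun (fun v => suc (f v)) :=
  .of_graph (.congr fun _ => isSucc_iff.symm)

instance DfnFun.sUn (f : (Fin n → U) → U) [DfnFun f] : DfnFun (fun v => sUn (f v)) :=
  have : Dfn (fun v : Fin (n + 1) → U => IsSet (v 0) ∧ ∀ z, Mem z (v 0) ↔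
      ∃ t, Mem t (f fun i => v i.succ) ∧ Mem z t) := inferInstance
  .of_graph (.congr (hP := this) fun v => by
    refine ⟨fun h => ?_, fun h => ext_set h.1 (isSet_sUn _) fun z => ?_⟩
    · rw [h]
      exact ⟨isSet_sUn _, fun z => mem_sUn⟩
    · rw [h.2, mem_sUn])

/-! ### The natural numbers of the model -/

theorem exists_omega : ∃ w : U, IsOmega w := by
  obtain ⟨-, w, hw, -⟩ := hU.dc (fun _ _ => True)
    (Dfn.out (P := fun _ : Fin 2 → U => True)) (fun x => ⟨x, trivial⟩) (emp U)
  exact ⟨w, hw⟩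

variable (U) in
/-- The set `ω` of the model. -/
noncomputable def om : U := (exists_omega (U := U)).choose

theorem isOmega_om : IsOmega (om U) := (exists_omega (U := U)).choose_spec

theorem isOmega_iff {w : U} : IsOmega w ↔ w = om U :=
  ⟨fun h => ext_set h.1 isOmega_om.1 fun z =>
    ⟨h.2.2 _ isOmega_om.2.1 z, isOmega_om.2.2 _ h.2.1 z⟩, by rintro rfl; exact isOmega_om⟩

theorem isInductive_iff {x : U} :
    IsInductive x ↔ Mem (emp U) x ∧ ∀ z, Mem z x → Mem (suc z) x := by
  simp [IsInductive, isEmptySet_iff, isSucc_iff]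

theorem emp_mem_om : Mem (emp U) (om U) := (isInductive_iff.1 isOmega_om.2.1).1

theorem suc_mem_om {n : U} (h : Mem n (om U)) : Mem (suc n) (om U) :=
  (isInductive_iff.1 isOmega_om.2.1).2 n h

/-- Induction on `ω` for definable predicates. -/
theorem om_induction (P : U → Prop) [Dfn (fun v : Fin 1 → U => P (v 0))] (h0 : P (emp U))
    (hs : ∀ n, Mem n (om U) → P n → P (suc n)) {n : U} (hn : Mem n (om U)) : P n := by
  obtain ⟨y, -, hy⟩ := exists_sep P (om U)
  have : IsInductive y := isInductive_iff.2
    ⟨(hy _).2 ⟨emp_mem_om, h0⟩, fun z hz => by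
      rw [hy] at hz ⊢
      exact ⟨suc_mem_om hz.1, hs z hz.1 hz.2⟩⟩
  exact ((hy n).1 (isOmega_om.2.2 _ this n hn)).2

theorem isSet_of_mem_om {n : U} (hn : Mem n (om U)) : IsSet n :=
  om_induction IsSet isSet_emp (fun n _ _ => isSet_suc n) hn

theorem mem_om_of_mem {n m : U} (hn : Mem n (om U)) (hm : Mem m n) : Mem m (om U) := by
  refine om_induction (fun n => ∀ m, Mem m n → Mem m (om U)) ?_ ?_ hn m hm
  · intro m hm
    exact absurd hm (not_mem_emp m)
  · intro n hn ih m hm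
    rcases mem_suc.1 hm with h | rfl
    exacts [ih m h, hn]

theorem om_mem_trans {n m k : U} (hn : Mem n (om U)) (hm : Mem m n) (hk : Mem k m) :
    Mem k n := by
  refine om_induction (fun n => ∀ m, Mem m n → ∀ k, Mem k m → Mem k n) ?_ ?_ hn m hm k hk
  · intro m hm
    exact absurd hm (not_mem_emp m)
  · intro n hn ih m hm k hk
    rcases mem_suc.1 hm with h | rfl
    exacts [mem_suc.2 (.inl (ih m h k hk)), mem_suc.2 (.inl hk)]

theorem om_trichotomy {m n : U} (hm : Mem m (om U)) (hn : Mem n (om U)) :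
    Mem m n ∨ m = n ∨ Mem n m := by
  have h0 : ∀ {n : U}, Mem n (om U) → Mem (emp U) n ∨ emp U = n := fun hn =>
    om_induction (fun n => Mem (emp U) n ∨ emp U = n) (.inr rfl) (fun n _ ih => .inl (by
      rwa [mem_suc])) hn
  have hsuc : ∀ {n : U}, Mem n (om U) → ∀ m, Mem m n → Mem (suc m) n ∨ suc m = n := fun hn =>
    om_induction (fun n => ∀ m, Mem m n → Mem (suc m) n ∨ suc m = n)
      (fun m hm => absurd hm (not_mem_emp m)) (fun n _ ih m hm => by
        rcases mem_suc.1 hm with h | rfl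
        · exact .inl (by rw [mem_suc]; exact ih m h)
        · exact .inr rfl) hn
  refine om_induction (fun m => ∀ n, Mem n (om U) → Mem m n ∨ m = n ∨ Mem n m) ?_ ?_ hm n hn
  · intro n hn
    rcases h0 hn with h | h
    exacts [.inl h, .inr (.inl h)]
  · intro m hm ih n hn
    rcases ih n hn with h | rfl | h
    · rcases hsuc hn m h with h | h
      exacts [.inl h, .inr (.inl h)]
    · exact .inr (.inr (mem_suc.2 (.inr rfl)))
    · exact .inr (.inr (mem_suc.2 (.inl h)))

/-! ### Transitive closures and induction along membership -/

/-- `t` contains the members of its members. -/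
def IsTrans (t : U) : Prop := ∀ z y, Mem z y → Mem y t → Mem z t

omit hU in
instance (f : (Fin n → U) → U) [DfnFun f] : Dfn (fun v => IsTrans (f v)) := by
  unfold IsTrans; infer_instance

/-- The DC-scheme for the functional relation `y = ⋃ x` yields the iterated unions of `{x}`,
hence a transitive set that contains `x`. -/
theorem exists_isTrans (x : U) : ∃ t, IsTrans t ∧ Mem x t := by
  obtain ⟨s, w, hw, ⟨-, -, hfun⟩, h0, hs⟩ := hU.dc (fun x y => y = sUn x)
    (Dfn.out (P := fun v : Fin 2 → U => v 1 = sUn (v 0))) (fun x => ⟨_, rfl⟩) (up x x)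
  rw [isOmega_iff] at hw
  subst hw
  obtain ⟨r, -, hr⟩ := exists_replacement (fun n y => App s n y) (om U) hfun
  refine ⟨sUn r, fun z y hz hy => ?_, ?_⟩
  · obtain ⟨c, hc, hyc⟩ := mem_sUn.1 hy
    obtain ⟨n, hn, hc⟩ := (hr c).1 hc
    obtain ⟨c', hc', -⟩ := hfun _ (suc_mem_om hn)
    have := hs n (suc n) hn (isSucc_iff.2 rfl) c c' hc hc'
    refine mem_sUn.2 ⟨c', (hr _).2 ⟨_, suc_mem_om hn, hc'⟩, ?_⟩
    rw [this]
    exact mem_sUn.2 ⟨y, hyc, hz⟩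
  · exact mem_sUn.2 ⟨up x x, (hr _).2 ⟨_, emp_mem_om, h0 _ (isEmptySet_iff.2 rfl)⟩, by simp⟩

/-- Induction along membership for definable predicates: the Foundation axiom is applied to the
counterexamples in a transitive set. -/
theorem mem_induction (P : U → Prop) [Dfn (fun v : Fin 1 → U => P (v 0))]
    (h : ∀ x, (∀ z, Mem z x → P z) → P x) (x : U) : P x := by
  by_contra hx
  obtain ⟨t, ht, hxt⟩ := exists_isTrans x
  obtain ⟨y, -, hy⟩ := exists_sep (fun z => ¬ P z) t
  obtain ⟨m, hm, hmin⟩ := hU.zfu.foundation y ⟨x, (hy x).2 ⟨hxt, hx⟩⟩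
  rw [hy] at hm
  refine hm.2 (h m fun z hz => ?_)
  by_contra hPz
  exact hmin z ⟨hz, (hy z).2 ⟨ht z m hz hm.1, hPz⟩⟩

theorem not_mem_self (x : U) : ¬ Mem x x :=
  mem_induction (fun x => ¬ Mem x x) (fun x ih hx => ih x hx hx) x

theorem not_mem_symm {x y : U} (h : Mem x y) : ¬ Mem y x := by
  refine mem_induction (fun x => ∀ y, Mem x y → ¬ Mem y x) (fun x ih y hxy hyx => ?_) x y h
  exact ih y hyx x hyx hxy

/-- The intersection of a transitive set containing `x` with all other ones is the transitive
closure of `{x}`. -/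
theorem exists_least_isTrans (x : U) :
    ∃ t, IsTrans t ∧ Mem x t ∧ ∀ t', IsTrans t' → Mem x t' → ∀ z, Mem z t → Mem z t' := by
  obtain ⟨t, ht, hxt⟩ := exists_isTrans x
  obtain ⟨y, -, hy⟩ := exists_sep (fun z => ∀ t', IsTrans t' → Mem x t' → Mem z t') t
  refine ⟨y, fun z w hz hw => ?_, (hy x).2 ⟨hxt, fun _ _ h => h⟩,
    fun t' ht' hx z hz => ((hy z).1 hz).2 t' ht' hx⟩
  rw [hy] at hw ⊢
  exact ⟨ht z w hz hw.1, fun t' ht' hx => ht' z w hz (hw.2 t' ht' hx)⟩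

/-! ### Binary relations and coinduction -/

/-- The restriction of a definable relation to two sets is a set of ordered pairs. The product of the
sets is obtained by applying Replacement twice. -/
theorem exists_relation (R : U → U → Prop) [hR : Dfn (fun v : Fin 2 → U => R (v 0) (v 1))]
    (a b : U) : ∃ g, ∀ x y, App g x y ↔ Mem x a ∧ Mem y b ∧ R x y := by
  have := fun {k : ℕ} (f g : (Fin k → U) → U) [DfnFun f] [DfnFun g] => hR.app₂ f g
  have h1 : ∀ x, ∃! s, IsSet s ∧ ∀ q, Mem q s ↔ ∃ y, Mem y b ∧ q = op x y := fun x => by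
    obtain ⟨s, hs⟩ := exists_replacement (fun y q => q = op x y) b (fun y _ => ⟨_, rfl, by simp⟩)
    exact ⟨s, hs, fun s' hs' => ext_set hs'.1 hs.1 fun z => by rw [hs'.2, hs.2]⟩
  obtain ⟨p, -, hp⟩ := exists_replacement
    (fun x s => IsSet s ∧ ∀ q, Mem q s ↔ ∃ y, Mem y b ∧ q = op x y) a (fun x _ => h1 x)
  obtain ⟨g, -, hg⟩ := exists_sep (fun q : U => ∃ x y, q = op x y ∧ R x y) (sUn p)
  refine ⟨g, fun x y => ?_⟩
  rw [app_iff, hg, mem_sUn]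
  constructor
  · rintro ⟨⟨s, hs, hq⟩, x', y', h, hR⟩
    obtain ⟨x'', hx, hs⟩ := (hp s).1 hs
    obtain ⟨y'', hy, hq⟩ := (hs.2 _).1 hq
    rw [op_inj] at h hq
    obtain ⟨rfl, rfl⟩ := h
    obtain ⟨rfl, rfl⟩ := hq
    exact ⟨hx, hy, hR⟩
  · rintro ⟨hx, hy, h⟩
    obtain ⟨s, hs, -⟩ := h1 x
    exact ⟨⟨s, (hp s).2 ⟨x, hx, hs⟩, (hs.2 _).2 ⟨y, hy, rfl⟩⟩, x, y, rfl, h⟩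

/-- One unfolding of a coinductively defined relation between objects: `B x y` holds, each member
of `x` is related to some member of `y`, and conversely if the flag `C` is set. -/
def CoStep (B : U → U → Prop) (C : Prop) (G : U → U → Prop) (x y : U) : Prop :=
  B x y ∧ (∀ a, Mem a x → ∃ b, Mem b y ∧ G a b) ∧ (C → ∀ b, Mem b y → ∃ a, Mem a x ∧ G a b)

/-- The union of all relations of the model that are closed under unfolding by `CoStep`. With the
flag `C` it is the bisimilarity, and without it the similarity, that respects `B`. -/
def Co (B : U → U → Prop) (C : Prop) (x y : U) : Prop :=
  ∃ g, App g x y ∧ ∀ x' y', App g x' y' → CoStep B C (App g) x' y'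

omit hU in
theorem Dfn.co {B : U → U → Prop} (hB : Dfn (fun v : Fin 2 → U => B (v 0) (v 1))) (C : Prop)
    (f g : (Fin n → U) → U) [DfnFun f] [DfnFun g] : Dfn (fun v => Co B C (f v) (g v)) := by
  have := fun {k : ℕ} (f g : (Fin k → U) → U) [DfnFun f] [DfnFun g] => hB.app₂ f g
  unfold Co CoStep
  infer_instance

omit hU in
theorem CoStep.mono {B : U → U → Prop} {C : Prop} {G H : U → U → Prop} {x y : U}
    (h : CoStep B C G x y) (hGH : ∀ a b, Mem a x → Mem b y → G a b → H a b) :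
    CoStep B C H x y :=
  ⟨h.1, fun a ha => let ⟨b, hb, hab⟩ := h.2.1 a ha; ⟨b, hb, hGH a b ha hb hab⟩,
    fun hC b hb => let ⟨a, ha, hab⟩ := h.2.2 hC b hb; ⟨a, ha, hGH a b ha hb hab⟩⟩

/-- `Co` is a fixed point of `CoStep`. For the direction from right to left, the restriction of
`Co` to the transitive closures, extended by the pair `(x, y)`, is a set. -/
theorem co_iff {B : U → U → Prop} (hB : Dfn (fun v : Fin 2 → U => B (v 0) (v 1))) {C : Prop}
    {x y : U} : Co B C x y ↔ CoStep B C (Co B C) x y := by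
  constructor
  · rintro ⟨g, hxy, hg⟩
    exact (hg x y hxy).mono fun a b _ _ hab => ⟨g, hab, hg⟩
  · intro h
    have := fun {k : ℕ} (f g : (Fin k → U) → U) [DfnFun f] [DfnFun g] => Dfn.co hB C f g
    obtain ⟨t, ht, hxt⟩ := exists_isTrans x
    obtain ⟨t', ht', hyt⟩ := exists_isTrans y
    obtain ⟨g, hg⟩ := exists_relation (fun a b => Co B C a b ∨ (a = x ∧ b = y)) t t'
    refine ⟨g, (hg x y).2 ⟨hxt, hyt, .inr ⟨rfl, rfl⟩⟩, fun a b hab => ?_⟩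
    obtain ⟨hat, hbt, hab⟩ := (hg a b).1 hab
    have : CoStep B C (Co B C) a b := by
      rcases hab with ⟨g', hab, hg'⟩ | ⟨rfl, rfl⟩
      · exact (hg' a b hab).mono fun c d _ _ hcd => ⟨g', hcd, hg'⟩
      · exact h
    exact this.mono fun c d hc hd hcd => (hg c d).2 ⟨ht c a hc hat, ht' d b hd hbt, .inl hcd⟩

end Basic

/-! ### Automorphisms induced by involutions of the urelements -/

/-- `σ` is an involutive automorphism of the structure `U`. -/
structure IsInvAut {U : Type u} [setLang.Structure U] (σ : U → U) : Prop where
  inv : ∀ x, σ (σ x) = x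
  mem : ∀ x y, Mem (σ x) (σ y) ↔ Mem x y
  ur : ∀ x, IsUr (σ x) ↔ IsUr x

section Automorphisms

variable {U : Type u} [setLang.Structure U] [hU : ZFUModel U]

/-- An involution `π` of the urelements with definable graph extends to an automorphism, which
maps a set `x` to the set of the images of the members of `x`. As `π` is definable, the recursion
along membership can be performed in the model: the graph of the extension is the bisimilarity
that restricts to `π` on the urelements. -/
theorem exists_isInvAut (π : U → U) (hπ : Dfn (fun v : Fin 2 → U => v 1 = π (v 0)))
    (hur : ∀ x, IsUr x → IsUr (π x)) (hinv : ∀ x, IsUr x → π (π x) = x) :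
    ∃ σ : U → U, IsInvAut σ ∧ (∀ x, IsUr x → σ x = π x) ∧
      ∀ t, IsTrans t → (∀ a, IsUr a → Mem a t → π a = a) → ∀ x, Mem x t → σ x = x := by
  let B : U → U → Prop := fun x y => (IsUr x ∧ IsUr y ∧ y = π x) ∨ (IsSet x ∧ IsSet y)
  have hB : Dfn (fun v : Fin 2 → U => B (v 0) (v 1)) := by
    have := fun {k : ℕ} (f g : (Fin k → U) → U) [DfnFun f] [DfnFun g] =>
      Dfn.app₂ (P := fun x y => y = π x) hπ f g
    dsimp only [B]
    infer_instance
  have iS := fun {k : ℕ} (f g : (Fin k → U) → U) [DfnFun f] [DfnFun g] => Dfn.co hB True f g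
  have hco := fun {x y : U} => co_iff (x := x) (y := y) hB (C := True)
  generalize hS : Co B True = S at iS hco
  have hurS : ∀ {x y}, S x y → IsUr x → IsUr y ∧ y = π x := fun h hx => by
    rcases (hco.1 h).1 with h | h
    exacts [h.2, absurd hx h.1]
  have hsetS : ∀ {x y}, S x y → IsSet x → IsSet y := fun h hx => by
    rcases (hco.1 h).1 with h | h
    exacts [absurd h.1 hx, h.2]
  have huniq : ∀ x y y', S x y → S x y' → y = y' := by
    refine fun x => mem_induction (fun x => ∀ y y', S x y → S x y' → y = y') ?_ x
    intro x ih y y' hy hy'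
    by_cases hx : IsUr x
    · rw [(hurS hy hx).2, (hurS hy' hx).2]
    · have key : ∀ {y y'}, S x y → S x y' → ∀ z, Mem z y → Mem z y' := by
        intro y y' hy hy' z hz
        obtain ⟨a, ha, haz⟩ := (hco.1 hy).2.2 trivial z hz
        obtain ⟨b, hb, hab⟩ := (hco.1 hy').2.1 a ha
        rwa [ih a ha z b haz hab]
      exact ext_set (hsetS hy hx) (hsetS hy' hx) fun z => ⟨key hy hy' z, key hy' hy z⟩
  have hex : ∀ x, ∃ y, S x y := by
    refine fun x => mem_induction (fun x => ∃ y, S x y) ?_ x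
    intro x ih
    by_cases hx : IsUr x
    · have hno := hU.zfu.urelements
      exact ⟨π x, hco.2 ⟨.inl ⟨hx, hur x hx, rfl⟩, fun a ha => absurd ha (hno x hx a),
        fun _ b hb => absurd hb (hno _ (hur x hx) b)⟩⟩
    · obtain ⟨y, hy, hmem⟩ := exists_replacement S x fun z hz =>
        let ⟨w, hw⟩ := ih z hz; ⟨w, hw, fun w' hw' => huniq z _ _ hw' hw⟩
      refine ⟨y, hco.2 ⟨.inr ⟨hx, hy⟩, fun a ha => ?_, fun _ b hb => (hmem b).1 hb⟩⟩
      obtain ⟨b, hb⟩ := ih a ha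
      exact ⟨b, (hmem b).2 ⟨a, ha, hb⟩, hb⟩
  have hinvS : ∀ x y z, S x y → S y z → z = x := by
    refine fun x => mem_induction (fun x => ∀ y z, S x y → S y z → z = x) ?_ x
    intro x ih y z hxy hyz
    by_cases hx : IsUr x
    · obtain ⟨hy, rfl⟩ := hurS hxy hx
      obtain ⟨-, rfl⟩ := hurS hyz hy
      exact hinv x hx
    · refine ext_set (hsetS hyz (hsetS hxy hx)) hx fun w => ⟨fun hw => ?_, fun hw => ?_⟩
      · obtain ⟨b, hb, hbw⟩ := (hco.1 hyz).2.2 trivial w hw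
        obtain ⟨a, ha, hab⟩ := (hco.1 hxy).2.2 trivial b hb
        rwa [ih a ha b w hab hbw]
      · obtain ⟨b, hb, hwb⟩ := (hco.1 hxy).2.1 w hw
        obtain ⟨c, hc, hbc⟩ := (hco.1 hyz).2.1 b hb
        rwa [← ih w hw b c hwb hbc]
  choose σ hσ using hex
  have hσσ : ∀ x, σ (σ x) = x := fun x => hinvS x _ _ (hσ x) (hσ _)
  have hmem : ∀ x y, Mem x y → Mem (σ x) (σ y) := fun x y h => by
    obtain ⟨b, hb, hxb⟩ := (hco.1 (hσ y)).2.1 x h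
    rwa [huniq x _ _ (hσ x) hxb]
  refine ⟨σ, ⟨hσσ, fun x y => ⟨fun h => ?_, hmem x y⟩, fun x => ⟨fun h => ?_, fun h => ?_⟩⟩,
    fun x hx => (hurS (hσ x) hx).2, fun t ht hfix x hx => ?_⟩
  · simpa [hσσ] using hmem _ _ h
  · simpa [hσσ] using (hurS (hσ (σ x)) h).1
  · exact (hurS (hσ x) h).1
  · refine huniq x _ _ (hσ x)
      (mem_induction (fun x => Mem x t → S x x) (fun x ih hx => ?_) x hx)
    refine hco.2 ⟨?_, fun a ha => ⟨a, ha, ih a ha (ht a x ha hx)⟩,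
      fun _ a ha => ⟨a, ha, ih a ha (ht a x ha hx)⟩⟩
    by_cases hxu : IsUr x
    exacts [.inl ⟨hxu, hxu, (hfix x hxu hx).symm⟩, .inr ⟨hxu, hxu⟩]

omit hU in
theorem IsInvAut.mem_apply {σ : U → U} (h : IsInvAut σ) {x y : U} :
    Mem x (σ y) ↔ Mem (σ x) y := by
  rw [← h.mem, h.inv]

theorem IsInvAut.up {σ : U → U} (h : IsInvAut σ) (a b : U) : σ (up a b) = up (σ a) (σ b) := by
  have hinv : ∀ x y, σ x = y ↔ x = σ y := fun x y =>
    ⟨fun e => by rw [← e, h.inv], fun e => by rw [e, h.inv]⟩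
  refine ext_set (fun hu => isSet_up a b ((h.ur _).1 hu)) (isSet_up _ _) fun z => ?_
  rw [h.mem_apply, mem_up, mem_up, hinv, hinv]

theorem IsInvAut.op {σ : U → U} (h : IsInvAut σ) (a b : U) : σ (op a b) = op (σ a) (σ b) := by
  simp [UrelementSet.op, h.up]

theorem IsInvAut.app_apply {σ : U → U} (h : IsInvAut σ) {s a b : U} :
    App (σ s) a b ↔ App s (σ a) (σ b) := by
  rw [app_iff, app_iff, h.mem_apply, h.op]

omit hU in
theorem IsInvAut.isTrans {σ : U → U} (h : IsInvAut σ) {t : U} (ht : IsTrans t) :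
    IsTrans (σ t) := fun z y hz hy => by
  rw [h.mem_apply] at hy ⊢
  exact ht _ _ ((h.mem _ _).2 hz) hy

/-! ### Automorphisms act on definable classes -/

/-- Definable sets are invariant under the automorphisms that fix the parameters. -/
theorem comp_mem_iff_of_definable {L : Language} {M α : Type*} [L.Structure M] {A : Set M}
    {S : Set (α → M)} (hS : A.Definable L S) (e : M ≃[L] M) (he : ∀ a ∈ A, e a = a)
    (v : α → M) : e ∘ v ∈ S ↔ v ∈ S := by
  obtain ⟨φ, rfl⟩ := Set.definable_iff_exists_formula_sum.1 hS
  have : (Sum.elim (↑) (e ∘ v) : A ⊕ α → M) = e ∘ Sum.elim (↑) v := by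
    ext (a | i)
    exacts [(he a a.2).symm, rfl]
  change φ.Realize _ ↔ φ.Realize _
  rw [this, Language.StrongHomClass.realize_formula]

theorem definable_comp {L : Language} {M α : Type*} [L.Structure M]
    {S : Set (α → M)} (hS : (Set.univ : Set M).Definable L S) (e : M ≃[L] M) :
    (Set.univ : Set M).Definable L {v | e ∘ v ∈ S} := by
  obtain ⟨φ, rfl⟩ := Set.definable_iff_exists_formula_sum.1 hS
  refine Set.definable_iff_exists_formula_sum.2
    ⟨φ.relabel (Sum.map (fun a : (Set.univ : Set M) =>
      (⟨e.symm a, trivial⟩ : (Set.univ : Set M))) id), ?_⟩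
  ext v
  have : (Sum.elim (↑) (e ∘ v) : (Set.univ : Set M) ⊕ α → M) =
      e ∘ (Sum.elim (↑) v ∘ Sum.map (fun a : (Set.univ : Set M) =>
        (⟨e.symm a, trivial⟩ : (Set.univ : Set M))) id) := by
    ext (a | i)
    exacts [(e.apply_symm_apply a).symm, rfl]
  change φ.Realize _ ↔ (φ.relabel _).Realize _
  rw [this, Language.StrongHomClass.realize_formula, Language.Formula.realize_relabel]

omit hU

/-- An involutive automorphism as an isomorphism of first-order structures. -/
def IsInvAut.toEquiv {σ : U → U} (h : IsInvAut σ) : U ≃[setLang] U where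
  toFun := σ
  invFun := σ
  left_inv := h.inv
  right_inv := h.inv
  map_fun' := fun f => Empty.elim f
  map_rel' := fun r v => by
    cases r with
    | mem =>
      have h1 : v = ![v 0, v 1] := by ext i; fin_cases i <;> rfl
      have h2 : σ ∘ v = ![σ (v 0), σ (v 1)] := by ext i; fin_cases i <;> rfl
      have h3 := h.mem (v 0) (v 1)
      unfold Mem at h3
      rwa [← h1, ← h2] at h3
    | ur =>
      have h1 : v = ![v 0] := by ext i; fin_cases i; rfl
      have h2 : σ ∘ v = ![σ (v 0)] := by ext i; fin_cases i; rfl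
      have h3 := h.ur (v 0)
      unfold IsUr at h3
      rwa [← h1, ← h2] at h3

/-- The image of a definable class under an involutive automorphism. -/
def IsInvAut.mapClass {σ : U → U} (h : IsInvAut σ) (X : DefClass U) : DefClass U :=
  ⟨{x | σ x ∈ X.1}, definable_comp X.2 h.toEquiv⟩

/-- An involutive automorphism extends to the definable classes. -/
def IsInvAut.mapSum {σ : U → U} (h : IsInvAut σ) : WithClasses U → WithClasses U :=
  Sum.map σ h.mapClass

theorem IsInvAut.mapSum_mapSum {σ : U → U} (h : IsInvAut σ) (z : WithClasses U) :
    h.mapSum (h.mapSum z) = z := by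
  rcases z with x | X
  · exact congrArg Sum.inl (h.inv x)
  · exact congrArg Sum.inr (Subtype.ext (by ext x; simp [mapClass, h.inv]))

/-- The extension of an automorphism to the definable classes respects the second-order
structure. -/
def IsInvAut.toEquivWithClasses {σ : U → U} (h : IsInvAut σ) :
    WithClasses U ≃[classLang] WithClasses U where
  toFun := h.mapSum
  invFun := h.mapSum
  left_inv := h.mapSum_mapSum
  right_inv := h.mapSum_mapSum
  map_fun' := fun f => Empty.elim f
  map_rel' := fun r v => by
    cases r with
    | mem =>
      change (∃ x y : U, h.mapSum (v 0) = .inl x ∧ h.mapSum (v 1) = .inl y ∧ Mem x y) ↔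
        ∃ x y : U, v 0 = .inl x ∧ v 1 = .inl y ∧ Mem x y
      rcases v 0 with x | X <;> rcases v 1 with y | Y <;> simp [mapSum, h.mem]
    | ur =>
      change (∃ x : U, h.mapSum (v 0) = .inl x ∧ IsUr x) ↔ ∃ x : U, v 0 = .inl x ∧ IsUr x
      rcases v 0 with x | X <;> simp [mapSum, h.ur]
    | isClass =>
      change (∃ X : DefClass U, h.mapSum (v 0) = .inr X) ↔ ∃ X : DefClass U, v 0 = .inr X
      rcases v 0 with x | X <;> simp [mapSum]
    | inClass =>
      change (∃ (x : U) (X : DefClass U), h.mapSum (v 0) = .inl x ∧ h.mapSum (v 1) = .inr X ∧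
        x ∈ X.1) ↔ ∃ (x : U) (X : DefClass U), v 0 = .inl x ∧ v 1 = .inr X ∧ x ∈ X.1
      rcases v 0 with x | X <;> rcases v 1 with y | Y <;> simp [mapSum]
      change σ (σ x) ∈ Y.1 ↔ x ∈ Y.1
      rw [h.inv]

include hU

theorem exists_superset_of_finset {ι : Type*} (s : Finset ι) (t : ι → U) :
    ∃ e : U, ∀ i ∈ s, ∀ z, Mem z (t i) → Mem z e := by
  classical
  induction s using Finset.induction_on with
  | empty => exact ⟨emp U, by simp⟩
  | insert i s _ ih =>
    obtain ⟨e, he⟩ := ih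
    refine ⟨un (t i) e, fun j hj z hz => mem_un.2 ?_⟩
    rcases Finset.mem_insert.1 hj with rfl | hj
    exacts [.inl hz, .inr (he j hj z hz)]

/-- Every definable class is fixed by the automorphisms that fix a suitable set pointwise. -/
theorem exists_support (z : WithClasses U) :
    ∃ e : U, ∀ σ : U → U, ∀ h : IsInvAut σ, (∀ x, Mem x e → σ x = x) → h.mapSum z = z := by
  rcases z with x | X
  · exact ⟨up x x, fun σ h hσ => congrArg Sum.inl (hσ x (by simp))⟩
  · obtain ⟨A, -, hA⟩ := Set.definable_iff_finitely_definable.1 X.2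
    obtain ⟨e, he⟩ := exists_superset_of_finset A (fun a : U => up a a)
    refine ⟨e, fun σ h hσ => congrArg Sum.inr (Subtype.ext (Set.ext fun x => ?_))⟩
    exact comp_mem_iff_of_definable hA h.toEquiv
      (fun a ha => hσ a (he a ha a (by simp))) (fun _ => x)

theorem exists_support_of_isParamDefinableMap {F : DefClass U → U}
    (hF : IsParamDefinableMap F) :
    ∃ e : U, IsTrans e ∧ ∀ σ : U → U, ∀ h : IsInvAut σ, (∀ x, Mem x e → σ x = x) →
      ∀ X, F (h.mapClass X) = σ (F X) := by
  obtain ⟨A, -, hA⟩ := Set.definable_iff_finitely_definable.1 hF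
  choose t ht using exists_support (U := U)
  obtain ⟨e, he⟩ := exists_superset_of_finset A t
  obtain ⟨e', he', hee'⟩ := exists_isTrans e
  refine ⟨e', he', fun σ h hσ X => ?_⟩
  have := (comp_mem_iff_of_definable hA h.toEquivWithClasses (fun a ha => ht a σ h fun x hx =>
    hσ x (he' x e (he a ha x hx) hee')) ![Sum.inr X, Sum.inl (F X)]).2 ⟨X, rfl⟩
  obtain ⟨Y, hY⟩ := this
  obtain ⟨h1, h2⟩ := Prod.mk.inj hY
  have h1 : h.mapClass X = Y := Sum.inr.inj h1
  have h2 : σ (F X) = F Y := Sum.inl.inj h2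
  rw [h1, h2]

end Automorphisms

section ProperClass

variable {U : Type u} [setLang.Structure U] [hU : ZFUModel U]

/-! ### Sequences of pairs of urelements -/

theorem exists_fresh_ur (hA : ¬ UrelementsFormSet U) (x : U) : ∃ a, IsUr a ∧ ¬ Mem a x := by
  by_contra! h
  obtain ⟨y, hy, hmem⟩ := exists_sep (fun z => IsUr z) x
  exact hA ⟨y, hy, fun z => (hmem z).trans ⟨And.right, fun hz => ⟨h z hz, hz⟩⟩⟩

/-- One step of the construction of a sequence of pairs of urelements: states are triples
`⟨⟨a, b⟩, f⟩`, where `f` collects the urelements that must not be used. -/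
def PairStep (x y : U) : Prop :=
  ∀ a b f, x = op (op a b) f → ∃ a' b' f', y = op (op a' b') f' ∧
    (IsUr a' ∧ IsUr b' ∧ a' ≠ b' ∧ ¬ Mem a' f' ∧ ¬ Mem b' f') ∧
    (∀ z, Mem z f → Mem z f') ∧ Mem a f' ∧ Mem b f'

/-- If the urelements do not form a set, the DC-scheme provides a sequence `s` of pairwise disjoint
pairs of distinct urelements outside of a given set. -/
theorem exists_disjoint_pairs (hA : ¬ UrelementsFormSet U) (e : U) :
    ∃ s, (∀ n, Mem n (om U) → ∃ a b, App s n (op a b)) ∧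
      (∀ n v, Mem n (om U) → App s n v → ∃ a b, v = op a b ∧
        IsUr a ∧ IsUr b ∧ a ≠ b ∧ ¬ Mem a e ∧ ¬ Mem b e) ∧
      (∀ n v v', Mem n (om U) → App s n v → App s n v' → v = v') ∧
      (∀ n m a b a' b', Mem n (om U) → Mem m n → App s m (op a b) → App s n (op a' b') →
        a ≠ a' ∧ a ≠ b' ∧ b ≠ a' ∧ b ≠ b') := by
  have hpair : ∀ f : U, ∃ a b, IsUr a ∧ IsUr b ∧ a ≠ b ∧ ¬ Mem a f ∧ ¬ Mem b f := fun f => by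
    obtain ⟨a, ha, haf⟩ := exists_fresh_ur hA f
    obtain ⟨b, hb, hbf⟩ := exists_fresh_ur hA (un f (up a a))
    simp only [mem_un, mem_up, or_self, not_or] at hbf
    exact ⟨a, b, ha, hb, fun h => hbf.2 h.symm, haf, hbf.1⟩
  obtain ⟨a₀, b₀, h₀⟩ := hpair e
  have hdfn : Dfn (fun v : Fin 2 → U => PairStep (v 0) (v 1)) := by
    unfold PairStep
    infer_instance
  obtain ⟨s, w, hw, ⟨-, -, hfun⟩, hs0, hs⟩ := hU.dc PairStep hdfn.out (fun x => by
    by_cases hx : ∃ a b f, x = op (op a b) f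
    · obtain ⟨a, b, f, rfl⟩ := hx
      obtain ⟨a', b', h⟩ := hpair (un f (up a b))
      refine ⟨op (op a' b') (un f (up a b)), fun a₁ b₁ f₁ h₁ => ⟨a', b', _, rfl, h, ?_⟩⟩
      simp only [op_inj] at h₁
      obtain ⟨⟨rfl, rfl⟩, rfl⟩ := h₁
      simp +contextual
    · exact ⟨x, fun a b f h => absurd ⟨a, b, f, h⟩ hx⟩) (op (op a₀ b₀) e)
  rw [isOmega_iff] at hw
  subst hw
  have huniq : ∀ {n y y'}, Mem n (om U) → App s n y → App s n y' → y = y' :=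
    fun hn hy hy' => (hfun _ hn).unique hy hy'
  have hstep : ∀ {n x y}, Mem n (om U) → App s n x → App s (suc n) y → PairStep x y :=
    fun hn hx hy => hs _ _ hn (isSucc_iff.2 rfl) _ _ hx hy
  have hval : ∀ {n}, Mem n (om U) → ∃ a b f, App s n (op (op a b) f) ∧
      (IsUr a ∧ IsUr b ∧ a ≠ b ∧ ¬ Mem a f ∧ ¬ Mem b f) ∧ ∀ z, Mem z e → Mem z f := by
    refine fun hn => om_induction (fun n => ∃ a b f, App s n (op (op a b) f) ∧
      (IsUr a ∧ IsUr b ∧ a ≠ b ∧ ¬ Mem a f ∧ ¬ Mem b f) ∧ ∀ z, Mem z e → Mem z f) ?_ ?_ hn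
    · exact ⟨a₀, b₀, e, hs0 _ (isEmptySet_iff.2 rfl), h₀, fun _ h => h⟩
    · rintro n hn ⟨a, b, f, hx, -, he⟩
      obtain ⟨y, hy, -⟩ := hfun _ (suc_mem_om hn)
      obtain ⟨a', b', f', rfl, h, hf, -⟩ := hstep hn hx hy a b f rfl
      exact ⟨a', b', f', hy, h, fun z hz => hf z (he z hz)⟩
  have hmono : ∀ {n}, Mem n (om U) → ∀ m a b f a' b' f', Mem m n → App s m (op (op a b) f) →
      App s n (op (op a' b') f') → Mem a f' ∧ Mem b f' := by
    refine fun hn => om_induction (fun n => ∀ m a b f a' b' f', Mem m n →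
      App s m (op (op a b) f) → App s n (op (op a' b') f') → Mem a f' ∧ Mem b f') ?_ ?_ hn
    · exact fun m _ _ _ _ _ _ hm => absurd hm (not_mem_emp m)
    · intro n hn ih m a b f a' b' f' hm hx hy
      obtain ⟨a₁, b₁, f₁, h₁, -⟩ := hval hn
      obtain ⟨a₂, b₂, f₂, h, -, hf, hab⟩ := hstep hn h₁ hy _ _ _ rfl
      simp only [op_inj] at h
      obtain ⟨⟨rfl, rfl⟩, rfl⟩ := h
      rcases mem_suc.1 hm with hm | rfl
      · obtain ⟨ha, hb⟩ := ih m a b f a₁ b₁ f₁ hm hx h₁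
        exact ⟨hf _ ha, hf _ hb⟩
      · have := huniq hn hx h₁
        simp only [op_inj] at this
        obtain ⟨⟨rfl, rfl⟩, rfl⟩ := this
        exact hab
  obtain ⟨t, -, ht⟩ := exists_replacement
    (fun n q => ∃ a b f, App s n (op (op a b) f) ∧ q = op n (op a b)) (om U) (by
      intro n hn
      obtain ⟨a, b, f, h, -⟩ := hval hn
      refine ⟨op n (op a b), ⟨a, b, f, h, rfl⟩, ?_⟩
      rintro _ ⟨a', b', f', h', rfl⟩
      have := huniq hn h h'
      simp only [op_inj] at this ⊢
      simp [this])
  have htapp : ∀ n v, App t n v ↔ Mem n (om U) ∧ ∃ a b f, App s n (op (op a b) f) ∧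
      v = op a b := fun n v => by
    rw [app_iff, ht]
    constructor
    · rintro ⟨m, hm, a, b, f, h, heq⟩
      obtain ⟨rfl, rfl⟩ := op_inj.1 heq
      exact ⟨hm, a, b, f, h, rfl⟩
    · rintro ⟨hm, a, b, f, h, rfl⟩
      exact ⟨n, hm, a, b, f, h, rfl⟩
  have key : ∀ n a b, App t n (op a b) → ∃ f, App s n (op (op a b) f) := by
    rintro n a b h
    obtain ⟨-, a', b', f, h, heq⟩ := (htapp _ _).1 h
    rw [heq]
    exact ⟨f, h⟩
  refine ⟨t, fun n hn => ?_, fun n v hn h => ?_, fun n v v' hn h h' => ?_,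
    fun n m a b a' b' hn hm h h' => ?_⟩
  · obtain ⟨a, b, f, h, -⟩ := hval hn
    exact ⟨a, b, (htapp _ _).2 ⟨hn, a, b, f, h, rfl⟩⟩
  · obtain ⟨-, a, b, f, hs₁, rfl⟩ := (htapp _ _).1 h
    obtain ⟨a', b', f', h', ⟨ha, hb, hab, haf, hbf⟩, he⟩ := hval hn
    obtain ⟨h1, rfl⟩ := op_inj.1 (huniq hn hs₁ h')
    obtain ⟨rfl, rfl⟩ := op_inj.1 h1
    exact ⟨a, b, rfl, ha, hb, hab, fun h => haf (he _ h), fun h => hbf (he _ h)⟩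
  · obtain ⟨-, a, b, f, hs₁, rfl⟩ := (htapp _ _).1 h
    obtain ⟨-, a', b', f', hs₂, rfl⟩ := (htapp _ _).1 h'
    exact (op_inj.1 (huniq hn hs₁ hs₂)).1
  · obtain ⟨f, h⟩ := key _ _ _ h
    obtain ⟨f', h'⟩ := key _ _ _ h'
    obtain ⟨ha, hb⟩ := hmono hn _ _ _ _ _ _ _ hm h h'
    obtain ⟨a₁, b₁, f₁, h₁, ⟨-, -, -, haf, hbf⟩, -⟩ := hval hn
    obtain ⟨h2, rfl⟩ := op_inj.1 (huniq hn h' h₁)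
    obtain ⟨rfl, rfl⟩ := op_inj.1 h2
    refine ⟨?_, ?_, ?_, ?_⟩ <;> rintro rfl <;> contradiction

/-! ### The tail class of a sequence and its automorphisms -/

/-- `x` agrees with `s` at all sufficiently large natural numbers. -/
def EqTail (s x : U) : Prop :=
  ∃ m, Mem m (om U) ∧ ∀ n, Mem n (om U) → Mem m n → ∀ v, App x n v ↔ App s n v

theorem exists_om_bound {m n : U} (hm : Mem m (om U)) (hn : Mem n (om U)) :
    ∃ k, Mem k (om U) ∧ ∀ l, Mem l (om U) → Mem k l → Mem m l ∧ Mem n l := by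
  rcases om_trichotomy hm hn with h | rfl | h
  · exact ⟨n, hn, fun l hl h' => ⟨om_mem_trans hl h' h, h'⟩⟩
  · exact ⟨m, hm, fun l _ h => ⟨h, h⟩⟩
  · exact ⟨m, hm, fun l hl h' => ⟨h', om_mem_trans hl h' h⟩⟩

theorem isTrans_om : IsTrans (om U) := fun _ _ hz hy => mem_om_of_mem hy hz

theorem mem_isTrans_of_app {t s n a b : U} (ht : IsTrans t) (hs : Mem s t)
    (h : App s n (op a b)) : Mem a t ∧ Mem b t := by
  have hab : Mem (op a b) t :=
    ht _ _ (mem_up.2 (.inr rfl)) (ht _ _ (mem_up.2 (.inr rfl)) (ht _ _ (app_iff.1 h) hs))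
  have hab' : Mem (up a b) t := ht _ _ (mem_up.2 (.inr rfl)) hab
  exact ⟨ht _ _ (mem_up.2 (.inl rfl)) hab', ht _ _ (mem_up.2 (.inr rfl)) hab'⟩

/-- The automorphism induced by the transposition of two urelements. -/
theorem exists_isInvAut_swap {c d : U} (hc : IsUr c) (hd : IsUr d) :
    ∃ σ : U → U, IsInvAut σ ∧ σ c = d ∧ (∀ x, IsUr x → x ≠ c → x ≠ d → σ x = x) ∧
      ∀ t, IsTrans t → ¬ Mem c t → ¬ Mem d t → ∀ x, Mem x t → σ x = x := by
  classical
  have hval : ∀ x, Equiv.swap c d x = if x = c then d else if x = d then c else x :=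
    fun x => Equiv.swap_apply_def c d x
  have hdfn : Dfn (fun v : Fin 2 → U => v 1 = Equiv.swap c d (v 0)) :=
    .congr (P := fun v : Fin 2 → U => (v 0 = c ∧ v 1 = d) ∨ (v 0 ≠ c ∧ v 0 = d ∧ v 1 = c) ∨
      (v 0 ≠ c ∧ v 0 ≠ d ∧ v 1 = v 0)) fun v => by rw [hval]; grind
  obtain ⟨σ, h, hσ, hfix⟩ := exists_isInvAut (Equiv.swap c d) hdfn
    (fun x hx => by rw [hval]; split_ifs <;> assumption) (fun x _ => Equiv.swap_apply_self c d x)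
  refine ⟨σ, h, by rw [hσ c hc, Equiv.swap_apply_left], fun x hx hxc hxd => ?_,
    fun t ht hct hdt => hfix t ht fun a _ ha => ?_⟩
  · rw [hσ x hx, Equiv.swap_apply_of_ne_of_ne hxc hxd]
  · exact Equiv.swap_apply_of_ne_of_ne (by rintro rfl; exact hct ha) (by rintro rfl; exact hdt ha)

/-- The automorphism that swaps the two entries of each member of a sequence of pairwise disjoint
pairs of urelements. -/
theorem exists_isInvAut_swap_pairs {s : U}
    (hval : ∀ n v, Mem n (om U) → App s n v → ∃ a b, v = op a b ∧ IsUr a ∧ IsUr b ∧ a ≠ b)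
    (huniq : ∀ n v v', Mem n (om U) → App s n v → App s n v' → v = v')
    (hdisj : ∀ n m a b a' b', Mem n (om U) → Mem m n → App s m (op a b) → App s n (op a' b') →
      a ≠ a' ∧ a ≠ b' ∧ b ≠ a' ∧ b ≠ b') :
    ∃ σ : U → U, IsInvAut σ ∧
      (∀ n a b, Mem n (om U) → App s n (op a b) → σ a = b ∧ σ b = a) ∧
      ∀ t, IsTrans t →
        (∀ n a b, Mem n (om U) → App s n (op a b) → ¬ Mem a t ∧ ¬ Mem b t) →
        ∀ x, Mem x t → σ x = x := by
  classical
  let P : U → U → Prop := fun x y => ∃ n, Mem n (om U) ∧ (App s n (op x y) ∨ App s n (op y x))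
  have hsymm : ∀ {x y}, P x y → P y x := fun ⟨n, hn, h⟩ => ⟨n, hn, h.symm⟩
  have hP : ∀ {x y y'}, P x y → P x y' → y = y' := by
    rintro x y y' ⟨n, hn, h⟩ ⟨m, hm, h'⟩
    rcases om_trichotomy hn hm with hnm | rfl | hmn
    · rcases h with h | h <;> rcases h' with h' | h' <;>
      · have := hdisj _ _ _ _ _ _ hm hnm h h'
        simp at this
    · rcases h with h | h <;> rcases h' with h' | h' <;>
      · have := op_inj.1 (huniq _ _ _ hn h h')
        grind
    · rcases h with h | h <;> rcases h' with h' | h' <;>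
      · have := hdisj _ _ _ _ _ _ hn hmn h' h
        simp at this
  have hPur : ∀ {x y}, P x y → IsUr y := by
    rintro x y ⟨n, hn, h | h⟩ <;>
    · obtain ⟨a, b, hab, ha, hb, -⟩ := hval _ _ hn h
      obtain ⟨rfl, rfl⟩ := op_inj.1 hab
      assumption
  let π : U → U := fun x => if h : ∃ y, P x y then h.choose else x
  have hπ : ∀ {x y}, P x y → π x = y := fun {x y} h => by
    have h' : ∃ y, P x y := ⟨y, h⟩
    simp only [π, dif_pos h']
    exact hP h'.choose_spec h
  have hπ' : ∀ {x}, (¬ ∃ y, P x y) → π x = x := fun h => by simp only [π, dif_neg h]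
  have hdfn : Dfn (fun v : Fin 2 → U => v 1 = π (v 0)) := by
    have : Dfn (fun v : Fin 2 → U => P (v 0) (v 1) ∨ ((¬ ∃ y, P (v 0) y) ∧ v 1 = v 0)) := by
      dsimp only [P]
      infer_instance
    refine .congr (hP := this) fun v => ?_
    by_cases h : ∃ y, P (v 0) y
    · obtain ⟨y, hy⟩ := h
      rw [hπ hy]
      exact ⟨fun h => .inl (h ▸ hy), fun h => h.elim (hP · hy) fun h => absurd ⟨y, hy⟩ h.1⟩
    · rw [hπ' h]
      exact ⟨fun h' => .inr ⟨h, h'⟩, fun h' => h'.elim (fun h' => absurd ⟨_, h'⟩ h) And.right⟩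
  obtain ⟨σ, h, hσ, hfix⟩ := exists_isInvAut π hdfn
    (fun x hx => by
      by_cases h : ∃ y, P x y
      · obtain ⟨y, hy⟩ := h
        rw [hπ hy]
        exact hPur hy
      · rwa [hπ' h])
    (fun x hx => by
      by_cases h : ∃ y, P x y
      · obtain ⟨y, hy⟩ := h
        rw [hπ hy, hπ (hsymm hy)]
      · rw [hπ' h, hπ' h])
  refine ⟨σ, h, fun n a b hn hab => ?_, fun t ht hst => hfix t ht fun a _ ha => hπ' ?_⟩
  · have h1 : P a b := ⟨n, hn, .inl hab⟩
    rw [hσ a (hPur (hsymm h1)), hσ b (hPur h1)]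
    exact ⟨hπ h1, hπ (hsymm h1)⟩
  · rintro ⟨y, n, hn, h | h⟩
    exacts [(hst _ _ _ hn h).1 ha, (hst _ _ _ hn h).2 ha]

/-- If the urelements do not form a set, there is no parametrically definable map that fulfills
Basic Law V. The tail class of a sequence `s` of disjoint pairs would be mapped to an object `y`.
If a term of `s` occurs in the transitive closure of `y`, its transposition with a fresh urelement
preserves the tail class but moves `y`; otherwise swapping all pairs preserves `y` but moves the
tail class. -/
theorem urelementsFormSet_of_isParamDefinableMap {F : DefClass U → U}
    (hF : IsParamDefinableMap F) (hV : FulfillsBLV F) : UrelementsFormSet U := by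
  by_contra hA
  obtain ⟨e, he, hsupp⟩ := exists_support_of_isParamDefinableMap hF
  obtain ⟨s, htot, hval, huniq, hdisj⟩ := exists_disjoint_pairs hA e
  have hX : Dfn (fun v : Fin 1 → U => EqTail s (v 0)) := by
    unfold EqTail
    infer_instance
  let X : DefClass U := ⟨{x | EqTail s x}, hX.out⟩
  obtain ⟨t, ht, hyt, hleast⟩ := exists_least_isTrans (F X)
  have hom : ∀ {σ : U → U}, IsInvAut σ → (∀ t, IsTrans t →
      (∀ a, IsUr a → ¬ Mem a t) → ∀ x, Mem x t → σ x = x) →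
      ∀ n, Mem n (om U) → σ n = n := fun _ h =>
    h _ isTrans_om fun a ha h => isSet_of_mem_om h ha
  by_cases hcase : ∃ n v c, Mem n (om U) ∧ App s n v ∧ (∃ a, v = op c a ∨ v = op a c) ∧ Mem c t
  · obtain ⟨n, v, c, hn, hv, ⟨d, hcd⟩, hct⟩ := hcase
    obtain ⟨a, b, hab, ha, hb, -, hae, hbe⟩ := hval _ _ hn hv
    have hc : IsUr c ∧ ¬ Mem c e := by
      rcases hcd with rfl | rfl <;> obtain ⟨rfl, rfl⟩ := op_inj.1 hab
      exacts [⟨ha, hae⟩, ⟨hb, hbe⟩]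
    -- `c'` avoids `t`, the support `e` and the terms of `s`
    obtain ⟨r, hr, hsr⟩ := exists_isTrans s
    obtain ⟨c', hc', hfresh⟩ := exists_fresh_ur hA (un t (un e r))
    simp only [mem_un, not_or] at hfresh
    obtain ⟨hc't, hc'e, hc'r⟩ := hfresh
    obtain ⟨σ, h, hσc, hσ, hfix⟩ := exists_isInvAut_swap hc.1 hc'
    -- the natural numbers are fixed, as no urelements occur in `ω`
    have hσom : ∀ n, Mem n (om U) → σ n = n := hom h fun t ht hur =>
      hfix t ht (hur c hc.1) (hur c' hc')
    have hfixv : ∀ k w, Mem k (om U) → Mem n k → App s k w → σ w = w := by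
      intro k w hk hnk hw
      obtain ⟨a', b', rfl, ha', hb', -⟩ := hval _ _ hk hw
      have h1 := mem_isTrans_of_app hr hsr hw
      have h2 : c ≠ a' ∧ c ≠ b' := by
        rcases hcd with rfl | rfl
        · have := hdisj _ _ _ _ _ _ hk hnk hv hw
          exact ⟨this.1, this.2.1⟩
        · have := hdisj _ _ _ _ _ _ hk hnk hv hw
          exact ⟨this.2.2.1, this.2.2.2⟩
      rw [h.op, hσ a' ha' h2.1.symm (by rintro rfl; exact hc'r h1.1),
        hσ b' hb' h2.2.symm (by rintro rfl; exact hc'r h1.2)]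
    have hmap : ∀ x, EqTail s x → EqTail s (σ x) := by
      rintro x ⟨m, hm, hx⟩
      obtain ⟨k, hk, hkl⟩ := exists_om_bound hm hn
      refine ⟨k, hk, fun l hl hkl' w => ?_⟩
      obtain ⟨hml, hnl⟩ := hkl l hl hkl'
      rw [h.app_apply, hσom l hl, hx l hl hml]
      refine ⟨fun hw => ?_, fun hw => ?_⟩
      · have := hfixv l _ hl hnl hw
        rw [h.inv] at this
        rwa [this]
      · rwa [hfixv l _ hl hnl hw]
    have hXfix : h.mapClass X = X := Subtype.ext (Set.ext fun x =>
      ⟨fun hx => h.inv x ▸ hmap (σ x) hx, hmap x⟩)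
    have hy : σ (F X) = F X := by
      rw [← hsupp σ h (hfix e he hc.2 hc'e) X, hXfix]
    have hcσ := hleast (σ t) (h.isTrans ht) (by rw [← hy, h.mem]; exact hyt) c hct
    rw [h.mem_apply, hσc] at hcσ
    exact hc't hcσ
  · have hst : ∀ n a b, Mem n (om U) → App s n (op a b) → ¬ Mem a t ∧ ¬ Mem b t :=
      fun n a b hn hab => ⟨fun hat => hcase ⟨n, _, a, hn, hab, ⟨b, .inl rfl⟩, hat⟩,
        fun hbt => hcase ⟨n, _, b, hn, hab, ⟨a, .inr rfl⟩, hbt⟩⟩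
    have hse : ∀ n a b, Mem n (om U) → App s n (op a b) → IsUr a ∧ IsUr b ∧ a ≠ b ∧
        ¬ Mem a e ∧ ¬ Mem b e := fun n a b hn hab => by
      obtain ⟨a', b', heq, h⟩ := hval _ _ hn hab
      obtain ⟨rfl, rfl⟩ := op_inj.1 heq
      exact h
    obtain ⟨σ, h, hσ, hfix⟩ := exists_isInvAut_swap_pairs
      (fun n v hn hv => let ⟨a, b, h1, h2, h3, h4, _⟩ := hval n v hn hv; ⟨a, b, h1, h2, h3, h4⟩)
      huniq hdisj
    have hσom : ∀ n, Mem n (om U) → σ n = n := hom h fun t ht hur =>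
      hfix t ht fun n a b hn hab =>
        ⟨hur a (hse n a b hn hab).1, hur b (hse n a b hn hab).2.1⟩
    have hy : F (h.mapClass X) = F X := by
      rw [hsupp σ h (hfix e he fun n a b hn hab => (hse n a b hn hab).2.2.2) X,
        hfix t ht hst _ hyt]
    have hsX : EqTail s s := ⟨emp U, emp_mem_om, fun _ _ _ _ => Iff.rfl⟩
    obtain ⟨m, hm, hσs⟩ : EqTail s (σ s) := ((hV _ _).1 hy s).2 hsX
    have hk := suc_mem_om hm
    obtain ⟨a, b, hab⟩ := htot _ hk
    obtain ⟨h1, h2⟩ := hσ _ _ _ hk hab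
    have := (hσs _ hk (mem_suc.2 (.inr rfl)) (op b a)).1 (by
      rwa [h.app_apply, hσom _ hk, h.op, h1, h2])
    exact (hse _ _ _ hk hab).2.2.1 (op_inj.1 (huniq _ _ _ hk hab this)).1

end ProperClass

/-! ### Comparison of ranks and Scott's trick -/

section Rank

variable {U : Type u} [setLang.Structure U]

/-- The rank of `x` is at most the rank of `y`, where urelements have rank zero. The rank is
compared by simulation, without recourse to ordinals. -/
def RankLe : U → U → Prop := Co (fun _ _ => True) False

instance {n : ℕ} (f g : (Fin n → U) → U) [DfnFun f] [DfnFun g] :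
    Dfn (fun v => RankLe (f v) (g v)) := Dfn.co inferInstance False f g

variable [hU : ZFUModel U]

theorem rankLe_iff {x y : U} :
    RankLe x y ↔ ∀ a, Mem a x → ∃ b, Mem b y ∧ RankLe a b := by
  unfold RankLe
  rw [co_iff inferInstance]
  simp [CoStep]

theorem RankLe.trans {x y z : U} (h : RankLe x y) (h' : RankLe y z) : RankLe x z := by
  refine mem_induction (fun x => ∀ y z, RankLe x y → RankLe y z → RankLe x z) ?_ x y z h h'
  intro x ih y z h h'
  rw [rankLe_iff] at h h' ⊢
  intro a ha
  obtain ⟨b, hb, hab⟩ := h a ha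
  obtain ⟨c, hc, hbc⟩ := h' b hb
  exact ⟨c, hc, ih a ha b c hab hbc⟩

/-- Ranks are linearly ordered: if `x` is not of rank at most that of `y`, then `y` has smaller rank,
that is, at most the rank of a member of `x`. -/
theorem rankLe_or_lt (x y : U) : RankLe x y ∨ ∃ a, Mem a x ∧ RankLe y a := by
  refine mem_induction (fun x => ∀ y, RankLe x y ∨ ∃ a, Mem a x ∧ RankLe y a) ?_ x y
  intro x ih y
  by_contra! h
  obtain ⟨hxy, h⟩ := h
  rw [rankLe_iff] at hxy
  push Not at hxy
  obtain ⟨a, ha, hay⟩ := hxy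
  refine h a ha (rankLe_iff.2 fun b hb => ?_)
  exact (ih a ha b).resolve_left (hay b hb)

/-- A nonempty definable class has a member of minimal rank. -/
theorem exists_rank_min (P : U → Prop) [Dfn (fun v : Fin 1 → U => P (v 0))] {c : U} (hc : P c) :
    ∃ c, P c ∧ ∀ c', P c' → RankLe c c' := by
  have hself : RankLe c c :=
    mem_induction (fun x => RankLe x x) (fun x ih => rankLe_iff.2 fun a ha => ⟨a, ha, ih a ha⟩) c
  have := fun {k : ℕ} (f : (Fin k → U) → U) [DfnFun f] => Dfn.app₁ (P := P) inferInstance f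
  have key : ∀ x, (∃ c, P c ∧ RankLe c x) → ∃ c, P c ∧ ∀ c', P c' → RankLe c c' := by
    refine mem_induction (fun x => (∃ c, P c ∧ RankLe c x) → ∃ c, P c ∧ ∀ c', P c' → RankLe c c')
      fun x ih => ?_
    rintro ⟨c, hc, hcx⟩
    by_contra hmin
    have : ∃ c', P c' ∧ ¬ RankLe c c' := by
      by_contra! h
      exact hmin ⟨c, hc, h⟩
    obtain ⟨c', hc', hlt⟩ := this
    obtain ⟨a, ha, hle⟩ := (rankLe_or_lt c c').resolve_left hlt
    obtain ⟨b, hb, hab⟩ := rankLe_iff.1 hcx a ha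
    exact hmin (ih b hb ⟨c', hc', hle.trans hab⟩)
  exact key c ⟨c, hc, hself⟩

/-- If the urelements form a set, then so do the objects of bounded rank. -/
theorem exists_set_rankLe (hA : UrelementsFormSet U) (y : U) :
    ∃ s, IsSet s ∧ ∀ c, Mem c s ↔ RankLe c y := by
  obtain ⟨A, hAset, hA⟩ := hA
  refine mem_induction (fun y => ∃ s, IsSet s ∧ ∀ c, Mem c s ↔ RankLe c y) (fun y ih => ?_) y
  obtain ⟨r, -, hr⟩ := exists_replacement
    (fun v s => IsSet s ∧ ∀ c, Mem c s ↔ RankLe c v) y fun v hv => by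
      obtain ⟨s, hs⟩ := ih v hv
      exact ⟨s, hs, fun s' hs' => ext_set hs'.1 hs.1 fun c => by rw [hs'.2, hs.2]⟩
  obtain ⟨P, hPset, hP⟩ := hU.zfu.powerset (sUn r)
  refine ⟨un P A, isSet_un _ _, fun c => ?_⟩
  have hsub : (∀ t, Mem t c → Mem t (sUn r)) ↔ RankLe c y := by
    rw [rankLe_iff]
    refine forall₂_congr fun a _ => ?_
    rw [mem_sUn]
    constructor
    · rintro ⟨s, hs, has⟩
      obtain ⟨v, hv, hs⟩ := (hr s).1 hs
      exact ⟨v, hv, (hs.2 a).1 has⟩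
    · rintro ⟨v, hv, hav⟩
      obtain ⟨s, hs⟩ := ih v hv
      exact ⟨s, (hr s).2 ⟨v, hv, hs⟩, (hs.2 a).2 hav⟩
  rw [mem_un, hP, hA, hsub]
  by_cases hc : IsUr c
  · refine iff_of_true (.inr hc) (rankLe_iff.2 fun a ha => ?_)
    exact absurd ha (hU.zfu.urelements c hc a)
  · simp [IsSet, hc]

/-- Scott's trick: the members of minimal rank of a nonempty definable class form a set. -/
theorem exists_scott_set (hA : UrelementsFormSet U) (P : U → Prop)
    [Dfn (fun v : Fin 1 → U => P (v 0))] {c : U} (hc : P c) :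
    ∃ s, IsSet s ∧ ∀ c, Mem c s ↔ P c ∧ ∀ c', P c' → RankLe c c' := by
  have := fun {k : ℕ} (f : (Fin k → U) → U) [DfnFun f] => Dfn.app₁ (P := P) inferInstance f
  obtain ⟨s, -, hs⟩ := exists_set_rankLe hA c
  obtain ⟨s', hs', hmem⟩ := exists_sep (fun c => P c ∧ ∀ c', P c' → RankLe c c') s
  exact ⟨s', hs', fun z => (hmem z).trans
    ⟨And.right, fun hz => ⟨(hs z).2 (hz.2 c hc), hz⟩⟩⟩

end Rank

/-! ### A cumulative hierarchy of uniformly definable relations -/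

section Hierarchy

variable {U : Type u} [setLang.Structure U]

/-- `t` is the numeral `k`. -/
def IsNum : ℕ → U → Prop
  | 0, t => IsEmptySet t
  | k + 1, t => ∃ e, IsNum k e ∧ IsSucc t e

/-- `q'` is the assignment `q` together with the value `x` at the label `i`. -/
def IsAdj (q' q i x : U) : Prop := IsSet q' ∧ ∀ z, Mem z q' ↔ Mem z q ∨ IsOPair z i x

/-- The assignment `q` satisfies the atomic formula with code `p = ⟨t, ⟨i, j⟩⟩`, where `i` and `j`
are labels of variables and `t` is a tag for the kind of the formula. -/
def AtomSat (p q : U) : Prop :=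
  ∃ t c i j x y, IsOPair p t c ∧ IsOPair c i j ∧ App q i x ∧ App q j y ∧
    ((IsNum 0 t ∧ Mem x y) ∨ (IsNum 1 t ∧ x = y) ∨ (IsNum 2 t ∧ IsUr x))

/-- Given a satisfaction relation `G` for codes of one level, the satisfaction relation of the next
level. The tags `0`, `1` and `2` stand for an implication, a universal quantification over the
variable with label `a`, and a formula of the previous level. -/
def StepSat (G : U → U → Prop) (p q : U) : Prop :=
  ∃ t c a b, IsOPair p t c ∧ IsOPair c a b ∧
    ((IsNum 0 t ∧ (G a q → G b q)) ∨ (IsNum 1 t ∧ ∀ x q', IsAdj q' q a x → G b q') ∨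
      (IsNum 2 t ∧ G a q))

/-- Satisfaction of codes of level `k`. -/
def Sat : ℕ → U → U → Prop
  | 0 => AtomSat
  | k + 1 => StepSat (Sat k)

variable {n : ℕ}

instance (k : ℕ) (f : (Fin n → U) → U) [DfnFun f] : Dfn (fun v => IsNum k (f v)) := by
  induction k generalizing n with
  | zero => unfold IsNum; infer_instance
  | succ k ih =>
    unfold IsNum
    have := fun {n : ℕ} (f : (Fin n → U) → U) [hf : DfnFun f] => ih f
    infer_instance

instance (f g h k : (Fin n → U) → U) [DfnFun f] [DfnFun g] [DfnFun h] [DfnFun k] :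
    Dfn (fun v => IsAdj (f v) (g v) (h v) (k v)) := by
  unfold IsAdj
  infer_instance

theorem Dfn.stepSat {G : U → U → Prop} (hG : Dfn (fun v : Fin 2 → U => G (v 0) (v 1)))
    (f g : (Fin n → U) → U) [DfnFun f] [DfnFun g] : Dfn (fun v => StepSat G (f v) (g v)) := by
  have := fun {k : ℕ} (f g : (Fin k → U) → U) [DfnFun f] [DfnFun g] => hG.app₂ f g
  unfold StepSat
  infer_instance

instance (f g : (Fin n → U) → U) [DfnFun f] [DfnFun g] : Dfn (fun v => AtomSat (f v) (g v)) := by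
  unfold AtomSat
  infer_instance

instance (k : ℕ) (f g : (Fin n → U) → U) [DfnFun f] [DfnFun g] :
    Dfn (fun v => Sat k (f v) (g v)) := by
  refine Dfn.app₂ (P := Sat k) ?_ f g
  induction k with
  | zero => unfold Sat; infer_instance
  | succ k ih => exact Dfn.stepSat ih _ _

variable [hU : ZFUModel U]

variable (U) in
/-- The numerals of the model. -/
noncomputable def num : ℕ → U
  | 0 => emp U
  | k + 1 => suc (num k)

theorem isNum_iff {k : ℕ} {t : U} : IsNum k t ↔ t = num U k := by
  induction k generalizing t with
  | zero => exact isEmptySet_iff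
  | succ k ih => simp [IsNum, ih, isSucc_iff, num]

theorem num_mem_om (k : ℕ) : Mem (num U k) (om U) := by
  induction k with
  | zero => exact emp_mem_om
  | succ k ih => exact suc_mem_om ih

theorem mem_num {k : ℕ} {m : U} : Mem m (num U k) ↔ ∃ j < k, m = num U j := by
  induction k with
  | zero => simp [num, not_mem_emp]
  | succ k ih =>
    rw [num, mem_suc, ih]
    constructor
    · rintro (⟨j, hj, rfl⟩ | rfl)
      exacts [⟨j, by omega, rfl⟩, ⟨k, by omega, rfl⟩]
    · rintro ⟨j, hj, rfl⟩
      rcases Nat.lt_succ_iff_lt_or_eq.1 hj with h | rfl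
      exacts [.inl ⟨j, h, rfl⟩, .inr rfl]

@[simp] theorem num_inj {j k : ℕ} : num U j = num U k ↔ j = k := by
  refine ⟨fun h => ?_, fun h => h ▸ rfl⟩
  by_contra hne
  rcases Nat.lt_or_gt_of_ne hne with hlt | hlt
  · exact not_mem_self (num U k) (mem_num.2 ⟨j, hlt, h.symm⟩)
  · exact not_mem_self (num U j) (mem_num.2 ⟨k, hlt, h⟩)

/-- The assignment `q` together with the value `x` at the label `i`. -/
noncomputable def adj (q i x : U) : U := un q (up (op i x) (op i x))

theorem isAdj_iff {q' q i x : U} : IsAdj q' q i x ↔ q' = adj q i x := by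
  refine ⟨fun h => ext_set h.1 (isSet_un _ _) fun z => ?_, ?_⟩
  · rw [h.2, isOPair_iff, adj, mem_un, mem_up, or_self]
  · rintro rfl
    exact ⟨isSet_un _ _, fun z => by simp [adj, isOPair_iff]⟩

theorem app_adj {q i x j y : U} : App (adj q i x) j y ↔ App q j y ∨ (j = i ∧ y = x) := by
  simp [adj]

theorem atomSat_op {t i j q : U} : AtomSat (op t (op i j)) q ↔
    ∃ x y, App q i x ∧ App q j y ∧
      ((t = num U 0 ∧ Mem x y) ∨ (t = num U 1 ∧ x = y) ∨ (t = num U 2 ∧ IsUr x)) := by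
  unfold AtomSat
  simp only [isOPair_iff, isNum_iff]
  constructor
  · rintro ⟨t', c, i', j', x, y, h1, rfl, h⟩
    simp only [op_inj] at h1
    obtain ⟨rfl, rfl, rfl⟩ := h1
    exact ⟨x, y, h⟩
  · rintro ⟨x, y, h⟩
    exact ⟨t, _, i, j, x, y, rfl, rfl, h⟩

theorem stepSat_op {G : U → U → Prop} {t a b q : U} : StepSat G (op t (op a b)) q ↔
    (t = num U 0 ∧ (G a q → G b q)) ∨ (t = num U 1 ∧ ∀ x, G b (adj q a x)) ∨
      (t = num U 2 ∧ G a q) := by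
  unfold StepSat
  simp only [isOPair_iff, isNum_iff, isAdj_iff, forall_eq]
  constructor
  · rintro ⟨t', c, a', b', h1, rfl, h⟩
    simp only [op_inj] at h1
    obtain ⟨rfl, rfl, rfl⟩ := h1
    exact h
  · intro h
    exact ⟨t, _, a, b, rfl, rfl, h⟩

theorem exists_code_succ (k : ℕ) (p : U) : ∃ p', ∀ q, Sat k p q ↔ Sat (k + 1) p' q :=
  ⟨op (num U 2) (op p p), fun q => by simp [Sat, stepSat_op]⟩

theorem exists_code_of_le {k k' : ℕ} (h : k ≤ k') (p : U) :
    ∃ p', ∀ q, Sat k p q ↔ Sat k' p' q := by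
  induction k', h using Nat.le_induction with
  | base => exact ⟨p, fun _ => Iff.rfl⟩
  | succ k' _ ih =>
    obtain ⟨p₁, h₁⟩ := ih
    obtain ⟨p₂, h₂⟩ := exists_code_succ k' p₁
    exact ⟨p₂, fun q => (h₁ q).trans (h₂ q)⟩

/-- The object `q` represents the assignment of the values `g 0, …, g (n - 1)` to the numerals as
labels of variables. -/
def Represents (q : U) (g : ℕ → U) (n : ℕ) : Prop :=
  ∀ j y, App q (num U j) y ↔ j < n ∧ y = g j

theorem Represents.adj {q : U} {g : ℕ → U} {n : ℕ} (h : Represents q g n) (x : U) :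
    Represents (adj q (num U n) x) (Function.update g n x) (n + 1) := fun j y => by
  rw [app_adj, h j y, num_inj]
  rcases lt_trichotomy j n with hj | rfl | hj
  · simp [hj, hj.ne, Nat.lt_succ_of_lt hj]
  · simp
  · simp [hj.not_gt, hj.ne', show ¬ j < n + 1 by omega]

theorem exists_represents (g : ℕ → U) (n : ℕ) : ∃ q, Represents q g n := by
  induction n with
  | zero => exact ⟨emp U, fun j y => by simp [not_mem_emp]⟩
  | succ n ih =>
    obtain ⟨q, hq⟩ := ih
    exact ⟨_, by simpa using hq.adj (g n)⟩

theorem Represents.atomSat {q : U} {g : ℕ → U} {n i j : ℕ} (h : Represents q g n) (hi : i < n)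
    (hj : j < n) (t : U) : AtomSat (op t (op (num U i) (num U j))) q ↔
      (t = num U 0 ∧ Mem (g i) (g j)) ∨ (t = num U 1 ∧ g i = g j) ∨
        (t = num U 2 ∧ IsUr (g i)) := by
  rw [atomSat_op]
  constructor
  · rintro ⟨x, y, hx, hy, h'⟩
    rw [((h _ _).1 hx).2, ((h _ _).1 hy).2] at h'
    exact h'
  · exact fun h' => ⟨g i, g j, (h _ _).2 ⟨hi, rfl⟩, (h _ _).2 ⟨hj, rfl⟩, h'⟩

omit hU in
theorem exists_label {α : Type*} {N n : ℕ} {l : α → ℕ} (hl : ∀ a, l a < N)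
    (t : setLang.Term (α ⊕ Fin n)) : ∃ j < N + n, ∀ (g : ℕ → U) (v : α → U) (xs : Fin n → U),
      (∀ a, g (l a) = v a) → (∀ i : Fin n, g (N + i) = xs i) →
      t.realize (Sum.elim v xs) = g j := by
  rcases t with (a | i) | ⟨f, -⟩
  · exact ⟨l a, by have := hl a; omega, fun g v xs hv _ => (hv a).symm⟩
  · exact ⟨N + i, by omega, fun g v xs _ hxs => (hxs i).symm⟩
  · exact Empty.elim f

/-- Every formula has a code. The free variables `a` carry the labels `l a < N`, and the `i`-th
bound variable carries the label `N + i`. -/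
theorem exists_code {α : Type*} {N n : ℕ} {l : α → ℕ} (hl : ∀ a, l a < N)
    (φ : setLang.BoundedFormula α n) : ∃ k, ∃ p : U, ∀ (g : ℕ → U) (q : U) (v : α → U)
      (xs : Fin n → U), (∀ a, g (l a) = v a) → (∀ i : Fin n, g (N + i) = xs i) →
      Represents q g (N + n) → (φ.Realize v xs ↔ Sat k p q) := by
  induction φ with
  | falsum =>
    refine ⟨0, op (num U 3) (op (emp U) (emp U)), fun g q v xs hv hxs hq => ?_⟩
    simp [Sat, atomSat_op, Language.BoundedFormula.Realize]
  | @equal n t₁ t₂ =>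
    obtain ⟨i, hi, h₁⟩ := exists_label (U := U) hl t₁
    obtain ⟨j, hj, h₂⟩ := exists_label (U := U) hl t₂
    refine ⟨0, op (num U 1) (op (num U i) (num U j)), fun g q v xs hv hxs hq => ?_⟩
    rw [Sat, hq.atomSat hi hj, Language.BoundedFormula.Realize, h₁ g v xs hv hxs,
      h₂ g v xs hv hxs]
    simp
  | @rel n m R ts =>
    choose i hi h using fun k => exists_label (U := U) hl (ts k)
    cases R with
    | mem =>
      refine ⟨0, op (num U 0) (op (num U (i 0)) (num U (i 1))), fun g q v xs hv hxs hq => ?_⟩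
      have : (fun k => (ts k).realize (Sum.elim v xs)) = ![g (i 0), g (i 1)] := by
        ext k
        rw [h k g v xs hv hxs]
        fin_cases k <;> rfl
      rw [Sat, hq.atomSat (hi 0) (hi 1)]
      change Language.Structure.RelMap (L := setLang) SetRel.mem
        (fun k => (ts k).realize (Sum.elim v xs)) ↔ _
      rw [this]
      simp [Mem]
    | ur =>
      refine ⟨0, op (num U 2) (op (num U (i 0)) (num U (i 0))), fun g q v xs hv hxs hq => ?_⟩
      have : (fun k => (ts k).realize (Sum.elim v xs)) = ![g (i 0)] := by
        ext k
        rw [h k g v xs hv hxs]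
        fin_cases k; rfl
      rw [Sat, hq.atomSat (hi 0) (hi 0)]
      change Language.Structure.RelMap (L := setLang) SetRel.ur
        (fun k => (ts k).realize (Sum.elim v xs)) ↔ _
      rw [this]
      simp [IsUr]
  | imp φ ψ ih₁ ih₂ =>
    obtain ⟨k₁, p₁, h₁⟩ := ih₁
    obtain ⟨k₂, p₂, h₂⟩ := ih₂
    obtain ⟨p₁', h₁'⟩ := exists_code_of_le (le_max_left k₁ k₂) p₁
    obtain ⟨p₂', h₂'⟩ := exists_code_of_le (le_max_right k₁ k₂) p₂
    refine ⟨max k₁ k₂ + 1, op (num U 0) (op p₁' p₂'), fun g q v xs hv hxs hq => ?_⟩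
    rw [Sat, stepSat_op, Language.BoundedFormula.Realize, h₁ g q v xs hv hxs hq,
      h₂ g q v xs hv hxs hq, h₁', h₂']
    simp
  | @all n φ ih =>
    obtain ⟨k, p, h⟩ := ih
    refine ⟨k + 1, op (num U 1) (op (num U (N + n)) p), fun g q v xs hv hxs hq => ?_⟩
    rw [Sat, stepSat_op, Language.BoundedFormula.Realize]
    have : ∀ x, φ.Realize v (Fin.snoc xs x) ↔ Sat k p (UrelementSet.adj q (num U (N + n)) x) := by
      refine fun x => h (Function.update g (N + n) x) _ v _ (fun a => ?_) (fun i => ?_) (hq.adj x)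
      · rw [Function.update_of_ne (by have := hl a; omega), hv]
      · refine Fin.lastCases ?_ (fun i => ?_) i
        · simp
        · have : (i : ℕ) < n := i.2
          rw [Fin.val_castSucc, Function.update_of_ne (by omega), hxs]
          simp
    simp [this]

/-- `c = ⟨p, ⟨l, r⟩⟩` codes, at level `k`, the class of all `x` such that the assignment `r`,
extended by the value `x` at the label `l`, satisfies `p`. -/
def CodesAt (k : ℕ) (c : U) (X : Set U) : Prop :=
  ∃ p l r, c = op p (op l r) ∧ ∀ x, x ∈ X ↔ Sat k p (adj r l x)

theorem exists_codesAt (X : DefClass U) : ∃ k c, CodesAt k c X.1 := by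
  obtain ⟨A, -, hA⟩ := Set.definable_iff_finitely_definable.1 X.2
  obtain ⟨φ, hφ⟩ := Set.definable_iff_exists_formula_sum.1 hA
  -- the parameters carry the labels below `A.card`, and the class variable the label `A.card`
  let l : (A : Set U) ⊕ Fin 1 → ℕ := Sum.elim (fun a => (A.equivFin a : ℕ)) (fun _ => A.card)
  have hl : ∀ a, l a < A.card + 1 := by
    rintro (a | i)
    · exact Nat.lt_succ_of_lt (A.equivFin a).2
    · exact Nat.lt_succ_self _
  obtain ⟨k, p, h⟩ := exists_code (U := U) hl φ
  let g : ℕ → U := fun j => if hj : j < A.card then A.equivFin.symm ⟨j, hj⟩ else emp U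
  obtain ⟨r, hr⟩ := exists_represents g A.card
  refine ⟨k, _, p, num U A.card, r, rfl, fun x => ?_⟩
  have hx : x ∈ X.1 ↔ φ.Realize (Sum.elim (↑) (fun _ : Fin 1 => x)) :=
    Set.ext_iff.1 hφ (fun _ => x)
  rw [hx]
  refine h (Function.update g A.card x) _ _ default ?_ (fun i => i.elim0) (hr.adj x)
  rintro (a | i)
  · have : l (Sum.inl a) ≠ A.card := (A.equivFin a).2.ne
    rw [Function.update_of_ne this]
    simp [g, l]
  · simp [l]

end Hierarchy

/-! ### Second-order definability without parameters -/

section SecondOrder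

variable {U : Type u} [setLang.Structure U] {n m : ℕ}

/-- `P` is a predicate on `n` objects and `m` definable classes that is definable by a second-order
formula without parameters. -/
class Dfn2 (P : (Fin n → U) → (Fin m → DefClass U) → Prop) : Prop where
  out : ∃ S : Set (Fin n ⊕ Fin m → WithClasses U), (∅ : Set (WithClasses U)).Definable classLang S ∧
    ∀ v w, Sum.elim (Sum.inl ∘ v) (Sum.inr ∘ w) ∈ S ↔ P v w

variable {P Q : (Fin n → U) → (Fin m → DefClass U) → Prop}

theorem Dfn2.congr [hP : Dfn2 P] (h : ∀ v w, Q v w ↔ P v w) : Dfn2 Q := by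
  have : Q = P := funext₂ fun v w => propext (h v w)
  rwa [this]

instance Dfn2.and [hP : Dfn2 P] [hQ : Dfn2 Q] : Dfn2 (fun v w => P v w ∧ Q v w) := by
  obtain ⟨S, hS, h⟩ := hP.out
  obtain ⟨T, hT, h'⟩ := hQ.out
  exact ⟨S ∩ T, hS.inter hT, fun v w => and_congr (h v w) (h' v w)⟩

instance Dfn2.or [hP : Dfn2 P] [hQ : Dfn2 Q] : Dfn2 (fun v w => P v w ∨ Q v w) := by
  obtain ⟨S, hS, h⟩ := hP.out
  obtain ⟨T, hT, h'⟩ := hQ.out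
  exact ⟨S ∪ T, hS.union hT, fun v w => or_congr (h v w) (h' v w)⟩

instance Dfn2.not [hP : Dfn2 P] : Dfn2 (fun v w => ¬ P v w) := by
  obtain ⟨S, hS, h⟩ := hP.out
  exact ⟨Sᶜ, hS.compl, fun v w => not_congr (h v w)⟩

instance Dfn2.imp [Dfn2 P] [Dfn2 Q] : Dfn2 (fun v w => P v w → Q v w) :=
  .congr (P := fun v w => ¬ P v w ∨ Q v w) fun _ _ => imp_iff_not_or

instance Dfn2.iff [Dfn2 P] [Dfn2 Q] : Dfn2 (fun v w => P v w ↔ Q v w) :=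
  .congr (P := fun v w => (P v w → Q v w) ∧ (Q v w → P v w)) fun _ _ => iff_def

instance Dfn2.constProp (p : Prop) : Dfn2 (U := U) (n := n) (m := m) (fun _ _ => p) := by
  by_cases hp : p
  exacts [⟨Set.univ, Set.definable_univ, fun _ _ => by simp [hp]⟩,
    ⟨∅, Set.definable_empty, fun _ _ => by simp [hp]⟩]

theorem definable_isClass {α : Type*} (i : α) : (∅ : Set (WithClasses U)).Definable classLang
    {g : α → WithClasses U | ∃ X : DefClass U, g i = Sum.inr X} := by
  rw [Set.empty_definable_iff]
  refine ⟨Language.Relations.formula₁ (L := classLang) ClassRel.isClass (.var i), ?_⟩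
  ext g
  exact (Language.Formula.realize_rel₁ (L := classLang) (M := WithClasses U)
    (R := ClassRel.isClass) (v := g) (t := .var i)).symm

instance Dfn2.ex {P : (Fin n → U) → (Fin m → DefClass U) → U → Prop}
    [hP : Dfn2 (fun (v : Fin (n + 1) → U) w => P (fun i => v i.succ) w (v 0))] :
    Dfn2 (fun v w => ∃ x, P v w x) := by
  obtain ⟨S, hS, h⟩ := hP.out
  refine ⟨_, (hS.inter (definable_isClass (Sum.inl 0)).compl).image_comp
    (Sum.map Fin.succ id : Fin n ⊕ Fin m → Fin (n + 1) ⊕ Fin m), fun v w => ⟨?_, ?_⟩⟩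
  · rintro ⟨g, ⟨hg, h0⟩, hgv⟩
    obtain ⟨x, hx⟩ : ∃ x : U, g (Sum.inl 0) = Sum.inl x := by
      rcases hg0 : g (Sum.inl 0) with x | X
      exacts [⟨x, rfl⟩, absurd ⟨X, hg0⟩ h0]
    have : g = Sum.elim (Sum.inl ∘ Fin.cons x v) (Sum.inr ∘ w) := by
      ext1 (i | j)
      · refine Fin.cases hx (fun i => ?_) i
        exact congrFun hgv (Sum.inl i)
      · exact congrFun hgv (Sum.inr j)
    rw [this, h] at hg
    exact ⟨x, by simpa using hg⟩
  · rintro ⟨x, hx⟩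
    refine ⟨Sum.elim (Sum.inl ∘ Fin.cons x v) (Sum.inr ∘ w), ⟨(h _ _).2 (by simpa using hx), ?_⟩, ?_⟩
    · rintro ⟨X, hX⟩
      simp at hX
    · ext1 (i | j) <;> simp

instance Dfn2.exClass {P : (Fin n → U) → (Fin m → DefClass U) → DefClass U → Prop}
    [hP : Dfn2 (fun v (w : Fin (m + 1) → DefClass U) => P v (fun i => w i.succ) (w 0))] :
    Dfn2 (fun v w => ∃ X, P v w X) := by
  obtain ⟨S, hS, h⟩ := hP.out
  refine ⟨_, (hS.inter (definable_isClass (Sum.inr 0))).image_comp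
    (Sum.map id Fin.succ : Fin n ⊕ Fin m → Fin n ⊕ Fin (m + 1)), fun v w => ⟨?_, ?_⟩⟩
  · rintro ⟨g, ⟨hg, X, hX⟩, hgv⟩
    have : g = Sum.elim (Sum.inl ∘ v) (Sum.inr ∘ Fin.cons X w) := by
      ext1 (i | j)
      · exact congrFun hgv (Sum.inl i)
      · refine Fin.cases hX (fun j => ?_) j
        exact congrFun hgv (Sum.inr j)
    rw [this, h] at hg
    exact ⟨X, by simpa using hg⟩
  · rintro ⟨X, hX⟩
    refine ⟨Sum.elim (Sum.inl ∘ v) (Sum.inr ∘ Fin.cons X w),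
      ⟨(h _ _).2 (by simpa using hX), X, by simp⟩, ?_⟩
    ext1 (i | j) <;> simp

instance Dfn2.all {P : (Fin n → U) → (Fin m → DefClass U) → U → Prop}
    [hP : Dfn2 (fun (v : Fin (n + 1) → U) w => P (fun i => v i.succ) w (v 0))] :
    Dfn2 (fun v w => ∀ x, P v w x) :=
  .congr (P := fun v w => ¬ ∃ x, ¬ P v w x) fun _ _ => by push Not; rfl

section Atoms

variable (i j k l : Fin n) (a : Fin m)

instance : Dfn2 (U := U) (m := m) (fun v _ => v i = v j) :=
  ⟨_, (Set.empty_definable_iff).2 ⟨(Language.var (Sum.inl i)).equal (Language.var (Sum.inl j)), rfl⟩,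
    fun v w => by
      change Language.Formula.Realize _ _ ↔ _
      rw [Language.Formula.realize_equal]
      exact Sum.inl_injective.eq_iff⟩

instance : Dfn2 (U := U) (m := m) (fun v _ => Mem (v i) (v j)) :=
  ⟨_, (Set.empty_definable_iff).2 ⟨Language.Relations.formula₂ (L := classLang) ClassRel.mem
      (.var (Sum.inl i)) (.var (Sum.inl j)), rfl⟩, fun v w => by
      refine (Language.Formula.realize_rel₂ (L := classLang) (M := WithClasses U)
        (R := ClassRel.mem) (v := Sum.elim (Sum.inl ∘ v) (Sum.inr ∘ w)) (t₁ := .var (Sum.inl i))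
        (t₂ := .var (Sum.inl j))).trans ⟨?_, fun h => ⟨v i, v j, rfl, rfl, h⟩⟩
      rintro ⟨x, y, hx, hy, h⟩
      obtain rfl := Sum.inl.inj hx
      obtain rfl := Sum.inl.inj hy
      exact h⟩

instance : Dfn2 (U := U) (m := m) (fun v _ => IsUr (v i)) :=
  ⟨_, (Set.empty_definable_iff).2 ⟨Language.Relations.formula₁ (L := classLang) ClassRel.ur
      (.var (Sum.inl i)), rfl⟩, fun v w => by
      refine (Language.Formula.realize_rel₁ (L := classLang) (M := WithClasses U)
        (R := ClassRel.ur) (v := Sum.elim (Sum.inl ∘ v) (Sum.inr ∘ w))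
        (t := .var (Sum.inl i))).trans ⟨?_, fun h => ⟨v i, rfl, h⟩⟩
      rintro ⟨x, hx, h⟩
      obtain rfl := Sum.inl.inj hx
      exact h⟩

instance : Dfn2 (U := U) (fun v w => v i ∈ (w a).1) :=
  ⟨_, (Set.empty_definable_iff).2 ⟨Language.Relations.formula₂ (L := classLang) ClassRel.inClass
      (.var (Sum.inl i)) (.var (Sum.inr a)), rfl⟩, fun v w => by
      refine (Language.Formula.realize_rel₂ (L := classLang) (M := WithClasses U)
        (R := ClassRel.inClass) (v := Sum.elim (Sum.inl ∘ v) (Sum.inr ∘ w))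
        (t₁ := .var (Sum.inl i))
        (t₂ := .var (Sum.inr a))).trans ⟨?_, fun h => ⟨v i, w a, rfl, rfl, h⟩⟩
      rintro ⟨x, X, hx, hX, h⟩
      obtain rfl := Sum.inl.inj hx
      obtain rfl := Sum.inr.inj hX
      exact h⟩

instance : Dfn2 (U := U) (m := m) (fun v _ => IsSet (v i)) := by
  unfold IsSet; infer_instance
instance : Dfn2 (U := U) (m := m) (fun v _ => IsEmptySet (v i)) := by
  unfold IsEmptySet; infer_instance
instance : Dfn2 (U := U) (m := m) (fun v _ => IsUPair (v i) (v j) (v k)) := by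
  unfold IsUPair; infer_instance
instance : Dfn2 (U := U) (m := m) (fun v _ => IsOPair (v i) (v j) (v k)) := by
  unfold IsOPair; infer_instance
instance : Dfn2 (U := U) (m := m) (fun v _ => IsSucc (v i) (v j)) := by
  unfold IsSucc; infer_instance
instance : Dfn2 (U := U) (m := m) (fun v _ => IsInductive (v i)) := by
  unfold IsInductive; infer_instance
instance : Dfn2 (U := U) (m := m) (fun v _ => IsOmega (v i)) := by
  unfold IsOmega; infer_instance
instance : Dfn2 (U := U) (m := m) (fun v _ => App (v i) (v j) (v k)) := by
  unfold App; infer_instance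
instance : Dfn2 (U := U) (m := m) (fun v _ => RankLe (v i) (v j)) := by
  unfold RankLe Co CoStep; infer_instance
instance : Dfn2 (U := U) (m := m) (fun v _ => IsAdj (v i) (v j) (v k) (v l)) := by
  unfold IsAdj; infer_instance

end Atoms
end SecondOrder

/-! ### Coding definable classes by objects -/

section Coding

variable {U : Type u} [setLang.Structure U]

/-- The section of the class `J` at index `m`, as a binary relation. -/
def Row (J : DefClass U) (m p q : U) : Prop :=
  ∃ z c, IsOPair c p q ∧ IsOPair z m c ∧ z ∈ J.1

/-- `J` is a class of triples whose sections at the indices up to `n` are the successive levels of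
the satisfaction hierarchy. -/
def IsRun (J : DefClass U) (n : U) : Prop :=
  ∀ m, (Mem m n ∨ m = n) → ∀ p q, Row J m p q ↔
    (IsEmptySet m ∧ AtomSat p q) ∨ ∃ k, IsSucc m k ∧ StepSat (Row J k) p q

/-- `c` codes the class `X` by means of the section of `J` at `n`. -/
def Decodes (J : DefClass U) (n c : U) (X : DefClass U) : Prop :=
  ∃ p d l r, IsOPair c p d ∧ IsOPair d l r ∧
    ∀ x, x ∈ X.1 ↔ ∃ q, IsAdj q r l x ∧ Row J n p q

/-- `y` is the set of all `⟨n, c⟩` such that `n` is the least level at which `X` has a code, and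
`c` is a code of `X` at this level of minimal rank. -/
def IsCode (X : DefClass U) (y : U) : Prop :=
  ∃ w n J, IsOmega w ∧ Mem n w ∧ IsRun J n ∧ (∃ c, Decodes J n c X) ∧
    (∀ m, Mem m n → ¬ ∃ c, Decodes J m c X) ∧ IsSet y ∧
    ∀ z, Mem z y ↔ ∃ c, IsOPair z n c ∧ Decodes J n c X ∧ ∀ c', Decodes J n c' X → RankLe c c'

instance {n m : ℕ} (c : ℕ) (i : Fin n) : Dfn2 (U := U) (m := m) (fun v _ => IsNum c (v i)) := by
  induction c generalizing n with
  | zero => unfold IsNum; infer_instance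
  | succ c ih =>
    unfold IsNum
    have := fun {n : ℕ} (i : Fin n) => ih i
    infer_instance

instance {n m : ℕ} (i j : Fin n) : Dfn2 (U := U) (m := m) (fun v _ => AtomSat (v i) (v j)) := by
  unfold AtomSat; infer_instance

instance {n m : ℕ} (a : Fin m) (i j k : Fin n) :
    Dfn2 (U := U) (fun v w => Row (w a) (v i) (v j) (v k)) := by
  unfold Row; infer_instance

instance {n m : ℕ} (a : Fin m) (i : Fin n) : Dfn2 (U := U) (fun v w => IsRun (w a) (v i)) := by
  unfold IsRun StepSat; infer_instance

instance {n m : ℕ} (a b : Fin m) (i j : Fin n) :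
    Dfn2 (U := U) (fun v w => Decodes (w a) (v i) (v j) (w b)) := by
  unfold Decodes; infer_instance

instance {n m : ℕ} (a : Fin m) (i : Fin n) : Dfn2 (U := U) (fun v w => IsCode (w a) (v i)) := by
  unfold IsCode; infer_instance

instance {n : ℕ} (X : DefClass U) (f : (Fin n → U) → U) [DfnFun f] :
    Dfn (fun v => f v ∈ X.1) := Dfn.app₁ (P := (· ∈ X.1)) ⟨X.2⟩ f

instance {n : ℕ} (J : DefClass U) (f g h : (Fin n → U) → U) [DfnFun f] [DfnFun g] [DfnFun h] :
    Dfn (fun v => Row J (f v) (g v) (h v)) := by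
  unfold Row; infer_instance

instance {n : ℕ} (J X : DefClass U) (f g : (Fin n → U) → U) [DfnFun f] [DfnFun g] :
    Dfn (fun v => Decodes J (f v) (g v) X) := by
  unfold Decodes; infer_instance

variable [hU : ZFUModel U]

theorem row_iff {J : DefClass U} {m p q : U} : Row J m p q ↔ op m (op p q) ∈ J.1 := by
  simp [Row, isOPair_iff]

theorem decodes_iff {J : DefClass U} {n c : U} {X : DefClass U} : Decodes J n c X ↔
    ∃ p l r, c = op p (op l r) ∧ ∀ x, x ∈ X.1 ↔ Row J n p (adj r l x) := by
  simp [Decodes, isOPair_iff, isAdj_iff]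

theorem isRun_iff {J : DefClass U} {n : U} : IsRun J n ↔ ∀ m, Mem m (suc n) → ∀ p q,
    Row J m p q ↔ (m = emp U ∧ AtomSat p q) ∨ ∃ k, m = suc k ∧ StepSat (Row J k) p q := by
  simp only [IsRun, isEmptySet_iff, isSucc_iff, mem_suc]

theorem suc_ne_emp (x : U) : suc x ≠ emp U := fun h =>
  not_mem_emp x (h ▸ mem_suc.2 (.inr rfl))

theorem suc_inj {x y : U} (h : suc x = suc y) : x = y := by
  have hx : Mem x (suc y) := h ▸ mem_suc.2 (.inr rfl)
  have hy : Mem y (suc x) := h ▸ mem_suc.2 (.inr rfl)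
  rcases mem_suc.1 hx with hx | rfl
  · rcases mem_suc.1 hy with hy | rfl
    · exact absurd hy (not_mem_symm hx)
    · rfl
  · rfl

theorem IsRun.row_emp {J : DefClass U} {n : U} (h : IsRun J n) (hn : Mem (emp U) (suc n))
    (p q : U) : Row J (emp U) p q ↔ AtomSat p q := by
  rw [isRun_iff.1 h _ hn]
  simp [(suc_ne_emp _).symm]

theorem IsRun.row_suc {J : DefClass U} {n m : U} (h : IsRun J n) (hm : Mem (suc m) (suc n))
    (p q : U) : Row J (suc m) p q ↔ StepSat (Row J m) p q := by
  rw [isRun_iff.1 h _ hm]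
  constructor
  · rintro (⟨h, -⟩ | ⟨k, h, hs⟩)
    · exact absurd h (suc_ne_emp _)
    · rwa [suc_inj h]
  · exact fun hs => .inr ⟨m, rfl, hs⟩

/-- Any two runs agree on their common indices. -/
theorem IsRun.unique {J J' : DefClass U} {n n' : U} (h : IsRun J n) (h' : IsRun J' n')
    (hn : Mem n (om U)) (hn' : Mem n' (om U)) {m : U} (hm : Mem m (suc n))
    (hm' : Mem m (suc n')) : Row J m = Row J' m := by
  have key : ∀ p q, Row J m p q ↔ Row J' m p q := by
    refine om_induction (fun m => Mem m (suc n) → Mem m (suc n') →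
      ∀ p q, Row J m p q ↔ Row J' m p q) ?_ ?_ (mem_om_of_mem (suc_mem_om hn) hm) hm hm'
    · intro h0 h0' p q
      rw [h.row_emp h0, h'.row_emp h0']
    · intro k hk ih hs hs' p q
      have hks : Mem k (suc k) := mem_suc.2 (.inr rfl)
      have : Row J k = Row J' k := funext₂ fun p q => propext (ih
        (om_mem_trans (suc_mem_om hn) hs hks) (om_mem_trans (suc_mem_om hn') hs' hks) p q)
      rw [h.row_suc hs, h'.row_suc hs', this]
  exact funext₂ fun p q => propext (key p q)

theorem exists_isRun (k : ℕ) :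
    ∃ J : DefClass U, IsRun J (num U k) ∧ ∀ j ≤ k, Row J (num U j) = Sat j := by
  have hdfn : Dfn (fun v : Fin 1 → U => ∃ j ≤ k, ∃ p q, v 0 = op (num U j) (op p q) ∧
      Sat j p q) := by
    induction k with
    | zero =>
      refine .congr (P := fun v : Fin 1 → U => ∃ p q, v 0 = op (num U 0) (op p q) ∧ Sat 0 p q)
        fun v => ?_
      simp
    | succ k ih =>
      refine .congr (P := fun v : Fin 1 → U => (∃ j ≤ k, ∃ p q, v 0 = op (num U j) (op p q) ∧
        Sat j p q) ∨ ∃ p q, v 0 = op (num U (k + 1)) (op p q) ∧ Sat (k + 1) p q) fun v => ?_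
      simp only [Nat.le_succ_iff, or_and_right, exists_or, exists_eq_left]
  let J : DefClass U := ⟨{z | ∃ j ≤ k, ∃ p q, z = op (num U j) (op p q) ∧ Sat j p q}, hdfn.out⟩
  have hJ : ∀ j ≤ k, Row J (num U j) = Sat j := by
    refine fun j hj => funext₂ fun p q => propext (row_iff.trans ⟨?_, fun h =>
      ⟨j, hj, p, q, rfl, h⟩⟩)
    rintro ⟨j', -, p', q', h, hs⟩
    simp only [op_inj, num_inj] at h
    obtain ⟨rfl, rfl, rfl⟩ := h
    exact hs
  refine ⟨J, isRun_iff.2 fun m hm p q => ?_, hJ⟩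
  obtain ⟨j, hj, rfl⟩ := mem_num.1 (show Mem m (num U (k + 1)) from hm)
  rw [hJ j (by omega)]
  cases j with
  | zero => simp [num, Sat, (suc_ne_emp _).symm]
  | succ j =>
    simp only [num, suc_ne_emp, false_and, false_or]
    constructor
    · intro h
      exact ⟨num U j, rfl, by rwa [hJ j (by omega)]⟩
    · rintro ⟨k', hk', h⟩
      rwa [← suc_inj hk', hJ j (by omega)] at h

theorem decodes_congr {J J' : DefClass U} {n : U} (h : Row J n = Row J' n) (c : U)
    (X : DefClass U) : Decodes J n c X ↔ Decodes J' n c X := by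
  rw [decodes_iff, decodes_iff, h]

/-- The least level at which a class has a code is unique: the indices of two candidates are
comparable, and the runs agree up to the smaller one. -/
theorem least_index_unique {J J' X : DefClass U} {n n' : U} (hn : Mem n (om U))
    (hn' : Mem n' (om U)) (hJ : IsRun J n) (hJ' : IsRun J' n') (hX : ∃ c, Decodes J n c X)
    (hX' : ∃ c, Decodes J' n' c X) (hmin : ∀ m, Mem m n → ¬ ∃ c, Decodes J m c X)
    (hmin' : ∀ m, Mem m n' → ¬ ∃ c, Decodes J' m c X) : n = n' := by
  rcases om_trichotomy hn hn' with h | h | h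
  · refine absurd ?_ (hmin' n h)
    simpa only [decodes_congr (hJ.unique hJ' hn hn' (mem_suc.2 (.inr rfl))
      (mem_suc.2 (.inl h)))] using hX
  · exact h
  · refine absurd ?_ (hmin n' h)
    simpa only [decodes_congr (hJ'.unique hJ hn' hn (mem_suc.2 (.inr rfl))
      (mem_suc.2 (.inl h)))] using hX'

theorem IsCode.unique {X : DefClass U} {y y' : U} (h : IsCode X y) (h' : IsCode X y') :
    y = y' := by
  obtain ⟨w, n, J, hw, hn, hJ, hX, hmin, hy, hmem⟩ := h
  obtain ⟨w', n', J', hw', hn', hJ', hX', hmin', hy', hmem'⟩ := h'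
  rw [isOmega_iff] at hw hw'
  subst hw hw'
  obtain rfl := least_index_unique hn hn' hJ hJ' hX hX' hmin hmin'
  have hrow := hJ.unique hJ' hn hn (mem_suc.2 (.inr rfl)) (mem_suc.2 (.inr rfl))
  refine ext_set hy hy' fun z => ?_
  rw [hmem, hmem']
  simp only [decodes_congr hrow]

theorem exists_isCode (hA : UrelementsFormSet U) (X : DefClass U) : ∃ y, IsCode X y := by
  classical
  have hex := exists_codesAt X
  obtain ⟨J, hJ, hrow⟩ := exists_isRun (U := U) (Nat.find hex)
  have hdec : ∀ j ≤ Nat.find hex, ∀ c, Decodes J (num U j) c X ↔ CodesAt j c X.1 :=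
    fun j hj c => by rw [decodes_iff, hrow j hj, CodesAt]
  obtain ⟨c, hc⟩ := Nat.find_spec hex
  have hc := (hdec _ le_rfl c).2 hc
  obtain ⟨s, -, hs⟩ := exists_scott_set hA (fun c => Decodes J (num U (Nat.find hex)) c X) hc
  obtain ⟨y, hy, hmem⟩ := exists_replacement (fun c z => z = op (num U (Nat.find hex)) c) s
    fun c _ => ⟨_, rfl, fun _ h => h⟩
  refine ⟨y, om U, _, J, isOmega_om, num_mem_om _, hJ, ⟨c, hc⟩, fun m hm => ?_, hy, fun z => ?_⟩
  · rintro ⟨c', hc'⟩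
    obtain ⟨j, hj, rfl⟩ := mem_num.1 hm
    exact Nat.find_min hex hj ⟨c', (hdec j hj.le c').1 hc'⟩
  · rw [hmem]
    simp only [hs, isOPair_iff]
    exact exists_congr fun c => and_comm

theorem IsCode.injective {X X' : DefClass U} {y : U} (h : IsCode X y) (h' : IsCode X' y) (x : U) :
    x ∈ X.1 ↔ x ∈ X'.1 := by
  obtain ⟨w, n, J, hw, hn, hJ, ⟨c, hc⟩, -, -, hmem⟩ := h
  obtain ⟨w', n', J', hw', hn', hJ', -, -, -, hmem'⟩ := h'
  rw [isOmega_iff] at hw hw'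
  subst hw hw'
  obtain ⟨c, hc, hmin⟩ := exists_rank_min (fun c => Decodes J n c X) hc
  have hz := (hmem (op n c)).2 ⟨c, isOPair_iff.2 rfl, hc, hmin⟩
  obtain ⟨c', heq, hc', -⟩ := (hmem' _).1 hz
  obtain ⟨rfl, rfl⟩ := op_inj.1 (isOPair_iff.1 heq)
  rw [← decodes_congr (hJ.unique hJ' hn hn (mem_suc.2 (.inr rfl)) (mem_suc.2 (.inr rfl))),
    decodes_iff] at hc'
  obtain ⟨p, l, r, rfl, hX⟩ := decodes_iff.1 hc
  obtain ⟨p', l', r', heq, hX'⟩ := hc'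
  simp only [op_inj] at heq
  obtain ⟨rfl, rfl, rfl⟩ := heq
  rw [hX, hX']

omit hU in
/-- A map from classes to objects with second-order definable graph is a definable map. -/
theorem isDefinableMap_of_dfn2 {F : DefClass U → U}
    (h : Dfn2 (fun (v : Fin 1 → U) (w : Fin 1 → DefClass U) => v 0 = F (w 0))) :
    IsDefinableMap F := by
  obtain ⟨S, hS, h⟩ := h.out
  have := ((hS.inter (definable_isClass (Sum.inl 0)).compl).inter
    (definable_isClass (Sum.inr 0))).preimage_comp
      (Sum.elim (fun _ => 1) (fun _ => 0) : Fin 1 ⊕ Fin 1 → Fin 2)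
  unfold IsDefinableMap Set.Definable₂
  convert! this using 1
  ext g
  constructor
  · rintro ⟨X, hX⟩
    obtain ⟨h0, h1⟩ := Prod.mk.inj hX
    refine ⟨⟨?_, ?_⟩, X, h0⟩
    · have := (h (fun _ => F X) (fun _ => X)).2 rfl
      convert! this using 1
      ext1 (i | i)
      exacts [h1, h0]
    · rintro ⟨Y, hY⟩
      have : g 1 = Sum.inr Y := hY
      simp [h1] at this
  · rintro ⟨⟨hg, h1⟩, X, h0⟩
    have h0 : g 0 = Sum.inr X := h0
    obtain ⟨x, hx⟩ : ∃ x : U, g 1 = Sum.inl x := by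
      rcases hg1 : g 1 with x | Y
      exacts [⟨x, rfl⟩, absurd ⟨Y, hg1⟩ h1]
    have hg : Sum.elim (Sum.inl ∘ fun _ => x) (Sum.inr ∘ fun _ => X) ∈ S := by
      convert! hg using 1
      ext1 (i | i)
      exacts [hx.symm, h0.symm]
    have := (h _ _).1 hg
    exact ⟨X, Prod.ext h0 (by rw [hx]; exact congrArg Sum.inl this)⟩

theorem exists_isDefinableMap (hA : UrelementsFormSet U) :
    ∃ F : DefClass U → U, IsDefinableMap F ∧ FulfillsBLV F := by
  choose F hF using exists_isCode hA
  have hdfn : Dfn2 (fun (v : Fin 1 → U) (w : Fin 1 → DefClass U) => IsCode (w 0) (v 0)) :=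
    inferInstance
  refine ⟨F, isDefinableMap_of_dfn2 (.congr (hP := hdfn) fun v w => ⟨fun h => ?_, fun h => ?_⟩),
    fun X Y => ⟨fun h => ?_, fun h => congrArg F (Subtype.ext (Set.ext h))⟩⟩
  · rw [h]
    exact hF _
  · exact h.unique (hF _)
  · have hX := hF X
    rw [h] at hX
    exact hX.injective (hF Y)

end Coding

end UrelementSet

theorem mainTheorem3 {U : Type*} [UrelementSet.setLang.Structure U]
    (hZFUR : UrelementSet.IsModelZFUR U) (hDC : UrelementSet.DCScheme U) :
    List.TFAE [
      UrelementSet.UrelementsFormSet U,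
      ∃ F : UrelementSet.DefClass U → U,
        UrelementSet.IsDefinableMap F ∧ UrelementSet.FulfillsBLV F,
      ∃ F : UrelementSet.DefClass U → U,
        UrelementSet.IsParamDefinableMap F ∧ UrelementSet.FulfillsBLV F] := by
  have : UrelementSet.ZFUModel U := ⟨hZFUR, hDC⟩
  tfae_have 1 → 2 := UrelementSet.exists_isDefinableMap
  tfae_have 2 → 3 := fun ⟨F, hF, hV⟩ => ⟨F, Set.Definable.mono hF (Set.empty_subset _), hV⟩
  tfae_have 3 → 1 := fun ⟨_, hF, hV⟩ =>
    UrelementSet.urelementsFormSet_of_isParamDefinableMap hF hV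
  tfae_finish
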